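/- Let $d\ge 2$, $n\ge 2$. Consider a unit linear program (Unit LP): maximize $\langle z,x\rangle$ subject to $\langle a_i,x\rangle\le 1$, $i=1,\dots,n$, with $z,a_1,\dots,a_n\in\mathbb{R}^d$ and the $a_i$ not all zero. Its *numb set* is the set of all $v\in\mathbb{R}^d$ such that adding the constraint $\langle v,x\rangle\le 1$ gives an equivalent program (the new program is bounded iff the old one is, and if they are bounded, they have the same solution; if optimal points are not unique, this means a common optimal point). Let $H$ be a *numb half-space*, i.e. a set $H=\{x:\langle w,x\rangle\le 0\}$ contained in the numb set. Put $M=\max_{i\le n}\|a_i\|$ and let $M_0\ge M$. Let $0<c\le c_1=\frac1{300}$ and $$\ell=\frac{c_1}{\sqrt{\log d}},\qquad \sigma_1=\min\Big(\frac{1}{6\sqrt{d\log n}},\ \frac{c}{d^{3/2}\log d}\Big).$$ Fix a unit vector $z_0'\in\mathbb{R}^d$ and the vertices $\bar a'_{n+1},\dots,\bar a'_{n+d}$ of a regular simplex whose center is $z_0'$, whose affine hull is orthogonal to $z_0'$, and with $\|z_0'-\bar a_i'\|=\ell$. For $U\in O(d)$, the procedure *Adding Constraints* sets $z_0=2M_0Uz_0'$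 and $\bar a_i=2M_0U\bar a_i'$, chooses independent Gaussian vectors $a_i$ with mean $\bar a_i$ and with independent coordinates of standard deviation $2M_0\sigma_1$ ($i=n+1,\dots,n+d$), and returns "Failure" unless (a) $z_0$ is a linear combination of $a_{n+1},\dots,a_{n+d}$ with non-negative coefficients, and (b) the distance from $0$ to the affine hull of $a_{n+1},\dots,a_{n+d}$ is at least $M$. Let (Unit LP$^+$) be the program with all the constraints $\langle a_i,x\rangle\le1$, $i=1,\dots,n+d$. Then: 1. For every $U\in O(d)$ and every outcome $a_{n+1},\dots,a_{n+d}$ of the smoothing: if the procedure does not return "Failure", then (Unit LP$^+$) with the objective function $\langle z_0,x\rangle$ has an optimal point $x$ with $\langle a_i,x\rangle=1$ for all $i=n+1,\dots,n+d$. If moreover $a_1,\dots,a_{n+d}$ are in general position (any at most $d+1$ of the vectors $(a_i,1)\in\mathbb{R}^{d+1}$ are linearly independent), then the index set $\{n+1,\dots,n+d\}$ is a solution of this program: there is an optimal point $x$ such that the constraints that are equalities at $x$ are exactly those with index in $\{n+1,\dots,n+d\}$, and $x$ is the only point satisfying these $d$ equations. 2. If $U$ is distributed according to the normalized Haar measure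 on $O(d)$, independently of the Gaussian smoothing, then with probability at least $\frac14$ the procedure does not return "Failure" and $a_{n+1},\dots,a_{n+d}\in H$. -/

import Mathlib

open MeasureTheory ProbabilityTheory

open scoped RealInnerProductSpace

/-- Euclidean space of dimension `d`. -/
abbrev Euc (d : ℕ) : Type := EuclideanSpace ℝ (Fin d)

namespace UnitLP

section Programs

variable {ι κ : Type*} {d : ℕ}

/-- A unit linear program is given by an objective vector `z` and constraint vectors `c i`:
maximize `⟪z, x⟫` subject to `⟪c i, x⟫ ≤ 1` for all `i`. This is its feasible set. -/
def feasibleSet (c : ι → Euc d) : Set (Euc d) := {x | ∀ i, ⟪c i, x⟫ ≤ 1}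

/-- The unit program is bounded: the objective is bounded above on the feasible set
(which is never empty, as it contains `0`). -/
def IsBounded (c : ι → Euc d) (z : Euc d) : Prop :=
  BddAbove ((fun x => ⟪z, x⟫) '' feasibleSet c)

/-- The point `x` solves the unit program. -/
def IsOptimal (c : ι → Euc d) (z x : Euc d) : Prop :=
  x ∈ feasibleSet c ∧ ∀ y ∈ feasibleSet c, ⟪z, y⟫ ≤ ⟪z, x⟫

/-- The `d`-set of indices `I` is a solution of the unit program: it is exactly the set of
the constraints that are equalities at some solution point `x`, and these `d` equations
determine `x`. -/
def IsSolution (c : ι → Euc d) (z : Euc d) (I : Finset ι) : Prop :=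
  I.card = d ∧ ∃ x, IsOptimal c z x ∧ (∀ i, i ∈ I ↔ ⟪c i, x⟫ = 1) ∧
    ∀ y, (∀ i ∈ I, ⟪c i, y⟫ = 1) → y = x

/-- Two unit programs with the same objective are equivalent: one is bounded iff the other one
is, and if they are bounded, they have the same solution. (When an optimal point is not unique,
this asks for an optimal point in common.) -/
def Equivalent (c : ι → Euc d) (c' : κ → Euc d) (z : Euc d) : Prop :=
  (IsBounded c' z ↔ IsBounded c z) ∧
    (IsBounded c z → ∃ x, IsOptimal c z x ∧ IsOptimal c' z x)

/-- The numb set of a unit program: the vectors `v` such that adding the constraint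
`⟪v, x⟫ ≤ 1` produces an equivalent program. -/
def numbSet {n : ℕ} (a : Fin n → Euc d) (z : Euc d) : Set (Euc d) :=
  {v | Equivalent a (Fin.snoc a v : Fin (n + 1) → Euc d) z}

/-- A numb half-space of a unit program: a half-space `{x | ⟪w, x⟫ ≤ 0}` that is contained in
the numb set. -/
def IsNumbHalfSpace {n : ℕ} (a : Fin n → Euc d) (z : Euc d) (H : Set (Euc d)) : Prop :=
  (∃ w : Euc d, H = {x | ⟪w, x⟫ ≤ 0}) ∧ H ⊆ numbSet a z

/-- The constraints `⟪c i, x⟫ ≤ 1` are in general position: any at most `d + 1` of the vectors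
`(c i, 1)` are linearly independent. -/
def GeneralPosition (c : ι → Euc d) : Prop :=
  ∀ s : Finset ι, s.card ≤ d + 1 →
    LinearIndependent ℝ (fun i : s => ((c i, 1) : Euc d × ℝ))

/-- The constraint vectors `a₁, …, aₙ, b₁, …, b_d` of the program with `d` added constraints. -/
abbrev augment {n : ℕ} (a : Fin n → Euc d) (b : Fin d → Euc d) : Fin (n + d) → Euc d :=
  Fin.append a b

/-- The set of the `d` indices of the added constraints. -/
def addedIndices (n d : ℕ) : Finset (Fin (n + d)) :=
  Finset.univ.map (Fin.natAddEmb n)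

end Programs

section OrthogonalGroup

/-- The orthogonal group `O(d)`. -/
abbrev O (d : ℕ) : Type := Matrix.orthogonalGroup (Fin d) ℝ

instance (d : ℕ) : MeasurableSpace (O d) := borel _

instance (d : ℕ) : BorelSpace (O d) := ⟨rfl⟩

instance (d : ℕ) : CompactSpace (O d) := by
  have hc : IsClosed ((Matrix.orthogonalGroup (Fin d) ℝ : Submonoid _) :
      Set (Matrix (Fin d) (Fin d) ℝ)) := isClosed_unitary
  refine isCompact_iff_compactSpace.mp ?_
  have hK : IsCompact (Set.pi Set.univ fun _ : Fin d =>
      Set.pi Set.univ fun _ : Fin d => Set.Icc (-1 : ℝ) 1) :=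
    isCompact_univ_pi fun _ => isCompact_univ_pi fun _ => isCompact_Icc
  refine IsCompact.of_isClosed_subset hK hc ?_
  intro A hA i _ j _
  have := entry_norm_bound_of_unitary (𝕜 := ℝ) hA i j
  exact abs_le.mp this

/-- The Haar measure of `O(d)`, normalized to total mass one. -/
noncomputable def haarO (d : ℕ) : Measure (O d) := Measure.haarMeasure ⊤

/-- The image of the vector `v` under `U ∈ O(d)`. -/
noncomputable def rotate {d : ℕ} (U : O d) (v : Euc d) : Euc d :=
  Matrix.toEuclideanLin (U : Matrix (Fin d) (Fin d) ℝ) v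

end OrthogonalGroup

section AddingConstraints

/-- The constant `c₁ = 1 / 300`. -/
noncomputable def c₁ : ℝ := 1 / 300

/-- The radius `ℓ = c₁ / √(log d)` of the regular simplex. -/
noncomputable def simplexRadius (d : ℕ) : ℝ := c₁ / √(Real.log d)

/-- The level of the smoothing,
`σ₁ = min (1 / (6 √(d log n)), c / (d^{3/2} log d))`. -/
noncomputable def smoothing (c : ℝ) (n d : ℕ) : ℝ :=
  min (1 / (6 * √(d * Real.log n))) (c / ((d : ℝ) ^ (3 / 2 : ℝ) * Real.log d))

variable {d : ℕ}

/-- `z₀` is a unit vector and the `v j` are the vertices of a regular simplex of dimension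
`d - 1` whose center is `z₀`, whose affine hull has the normal `z₀`, and whose radius is `r`. -/
structure IsRegularSimplex (z₀ : Euc d) (v : Fin d → Euc d) (r : ℝ) : Prop where
  norm_center : ‖z₀‖ = 1
  center : (d : ℝ)⁻¹ • ∑ j, v j = z₀
  normal : ∀ j, ⟪z₀, v j - z₀⟫ = 0
  radius : ∀ j, ‖z₀ - v j‖ = r
  regular : ∃ s : ℝ, ∀ i j, i ≠ j → ‖v i - v j‖ = s

/-- The rotated and dilated vector `2 M₀ U v`. -/
noncomputable def rotateDilate (M₀ : ℝ) (U : O d) (v : Euc d) : Euc d :=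
  (2 * M₀) • rotate U v

/-- The smoothed vertices: the mean of the `j`-th one is the rotated and dilated vertex `v j`,
and `g j` is the standard Gaussian noise, which enters with standard deviation `2 M₀ σ`. -/
noncomputable def smoothedVertices (M₀ σ : ℝ) (v : Fin d → Euc d) (U : O d) (g : Fin d → Euc d) :
    Fin d → Euc d :=
  fun j => rotateDilate M₀ U (v j) + (2 * M₀ * σ) • g j

/-- The law of `d` independent standard Gaussian vectors in `ℝ^d`. -/
noncomputable def gaussianNoise (d : ℕ) : Measure (Fin d → Euc d) :=
  Measure.pi fun _ => stdGaussian (Euc d)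

/-- The non-negative cone generated by the vectors `b j`. -/
def cone (b : Fin d → Euc d) : Set (Euc d) :=
  {x | ∃ t : Fin d → ℝ, (∀ j, 0 ≤ t j) ∧ x = ∑ j, t j • b j}

/-- The final check of the procedure succeeds (no "Failure"): the objective vector `z₀` is in the
cone of the added constraint vectors `b j`, and the affine hull of the `b j` is at distance at
least `M` from the origin. -/
def NoFailure (M : ℝ) (z₀ : Euc d) (b : Fin d → Euc d) : Prop :=
  z₀ ∈ cone b ∧ M ≤ Metric.infDist 0 (affineSpan ℝ (Set.range b) : Set (Euc d))

end AddingConstraints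

end UnitLP

/-! Deterministic part. If the affine hull of the added vectors `b j` has distance at least `M` from
`0`, the system `⟪b j, x⟫ = 1` has a solution with `M * ‖x‖ ≤ 1`. By Cauchy–Schwarz this point
satisfies the old constraints, and since the objective lies in `cone b` it is optimal. General
position makes the `b j` a basis and forbids a further tight constraint.

Probabilistic part. After dividing by `2 * M₀`, everything reduces to the noise event `SmallNoise`.
On it the procedure cannot fail: a separating vector showing that the axis `z` misses the cone would
contradict the isotropy of the simplex (`exists_mem_stdSimplex_of_smallNoise`), and an affine
combination near `0` would need such large coefficients that the spread of the simplex beats the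
noise (`half_le_norm_of_smallNoise`). Chebyshev and Markov bounds, with exact tails when `d = 2`,
show that `SmallNoise` fails with probability at most 0.415.

For the half-space, invariance of Haar measure and of the Gaussian law under rotations makes the
success probability the same for every nonzero normal `w`, so `w` may be replaced by a Gaussian
vector `x` and the rotation may be fixed. Outside events of small probability, `⟪x, z⟫` dominates
the deviations of all smoothed vertices from `z`, so all vertices lie strictly on one side of the
hyperplane. The symmetry `x ↦ -x` gives each side the same chance, and half of what remains after
the bad events exceeds 1/4 (`one_fourth_le_prod_smallNoise`, `one_fourth_le_measure_goodEvent`). -/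

namespace UnitLP

/-! ### Optimality at the intersection of the added constraints -/

/-- If the affine hull of `b` is at distance at least `M > 0` from the origin, then the equations
`⟪b j, x⟫ = 1` have a common solution of norm at most `1 / M`. -/
theorem exists_inner_eq_one_of_le_infDist {d : ℕ} [NeZero d] (b : Fin d → Euc d) {M : ℝ}
    (hM : 0 < M) (hb : M ≤ Metric.infDist 0 (affineSpan ℝ (Set.range b) : Set (Euc d))) :
    ∃ x : Euc d, (∀ j, ⟪b j, x⟫ = 1) ∧ M * ‖x‖ ≤ 1 := by
  set s := affineSpan ℝ (Set.range b)
  have : Nonempty s := ⟨⟨b 0, subset_affineSpan ℝ _ ⟨0, rfl⟩⟩⟩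
  -- `p` is the foot of the perpendicular from `0`; the hull lies in the hyperplane `⟪y, p⟫ = ‖p‖ ^
  -- 2`, so rescaling `p` gives the solution.
  set p : Euc d := ↑(EuclideanGeometry.orthogonalProjection s (0 : Euc d)) with hp
  have hps : p ∈ s := EuclideanGeometry.orthogonalProjection_mem _
  have hMp : M ≤ ‖p‖ := by
    refine hb.trans ((Metric.infDist_le_dist_of_mem hps).trans ?_)
    simp
  have hp0 : 0 < ‖p‖ := hM.trans_le hMp
  have hperp : ∀ y ∈ s, ⟪y, p⟫ = ‖p‖ ^ 2 := by
    intro y hy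
    have h1 := EuclideanGeometry.vsub_orthogonalProjection_mem_direction_orthogonal s (0 : Euc d)
    have h2 : y -ᵥ p ∈ s.direction := AffineSubspace.vsub_mem_direction hy hps
    have h3 := (Submodule.mem_orthogonal _ _).1 h1 _ h2
    rw [← hp] at h3
    simp only [vsub_eq_sub, zero_sub, inner_neg_right, inner_sub_left,
      real_inner_self_eq_norm_sq] at h3
    linarith
  refine ⟨(‖p‖ ^ 2)⁻¹ • p, fun j => ?_, ?_⟩
  · rw [inner_smul_right, hperp _ (subset_affineSpan ℝ _ ⟨j, rfl⟩)]
    field_simp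
  · rw [norm_smul, norm_inv, norm_pow, norm_norm]
    have : M * ((‖p‖ ^ 2)⁻¹ * ‖p‖) = M / ‖p‖ := by field_simp
    rw [this]
    exact (div_le_one hp0).2 hMp

variable {d n : ℕ}

/-- A feasible point at which the added constraints are tight is optimal for every objective in the
cone of the added constraint vectors. -/
theorem isOptimal_augment {a : Fin n → Euc d} {b : Fin d → Euc d} {z x : Euc d}
    (hz : z ∈ cone b) (ha : ∀ i, ⟪a i, x⟫ ≤ 1) (hb : ∀ j, ⟪b j, x⟫ = 1) :
    IsOptimal (augment a b) z x := by
  obtain ⟨t, ht, rfl⟩ := hz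
  refine ⟨fun i => ?_, fun y hy => ?_⟩
  · refine Fin.addCases (fun i => ?_) (fun j => ?_) i
    · simpa [augment] using ha i
    · simpa [augment] using (hb j).le
  · simp only [sum_inner, real_inner_smul_left]
    refine Finset.sum_le_sum fun j _ => mul_le_mul_of_nonneg_left ?_ (ht j)
    rw [hb j]
    simpa [augment] using hy (Fin.natAdd n j)

/-- Pairing a relation among the `b j` with `x` shows that its coefficients sum to zero, so it is
also a relation among the lifted vectors `(b j, 1)`. -/
theorem linearIndependent_of_inner_eq_one {ι : Type*} [Fintype ι] {b : ι → Euc d} {x : Euc d}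
    (hb : ∀ j, ⟪b j, x⟫ = 1)
    (h : LinearIndependent ℝ fun j => ((b j, 1) : Euc d × ℝ)) : LinearIndependent ℝ b := by
  rw [Fintype.linearIndependent_iff] at h ⊢
  intro t ht
  refine h t ?_
  have h1 : ∑ j, t j = 0 := by
    have := congrArg (fun y => ⟪y, x⟫) ht
    simpa [sum_inner, real_inner_smul_left, hb] using this
  ext1
  · simpa [Prod.fst_sum] using ht
  · simpa [Prod.snd_sum] using h1

theorem GeneralPosition.linearIndependent_comp {ι κ : Type*} [Fintype κ] {c : ι → Euc d}
    (h : GeneralPosition c) {f : κ → ι} (hf : f.Injective) (hκ : Fintype.card κ ≤ d + 1) :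
    LinearIndependent ℝ fun k => ((c (f k), 1) : Euc d × ℝ) := by
  have h1 := h (Finset.univ.map ⟨f, hf⟩) (by simpa using hκ)
  have hinj : Function.Injective
      (fun k => (⟨f k, by simp⟩ : (Finset.univ.map ⟨f, hf⟩ : Finset ι))) := by
    intro k l hkl
    exact hf (congrArg Subtype.val hkl)
  exact h1.comp _ hinj

theorem isSolution_augment {a : Fin n → Euc d} {b : Fin d → Euc d} {z x : Euc d}
    (hx : IsOptimal (augment a b) z x) (hb : ∀ j, ⟪b j, x⟫ = 1)
    (hgp : GeneralPosition (augment a b)) :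
    IsSolution (augment a b) z (addedIndices n d) := by
  have hbl : LinearIndependent ℝ b := by
    refine linearIndependent_of_inner_eq_one hb ?_
    have := hgp.linearIndependent_comp (f := Fin.natAdd n) (Fin.natAdd_injective d n) (by simp)
    simpa [augment] using this
  have hspan : Submodule.span ℝ (Set.range b) = ⊤ :=
    hbl.span_eq_top_of_card_eq_finrank' (by simp)
  refine ⟨by simp [addedIndices], x, hx, fun i => ?_, fun y hy => ?_⟩
  · refine Fin.addCases (fun i => ?_) (fun j => ?_) i
    · have h1 : Fin.castAdd d i ∉ addedIndices n d := by
        simp only [addedIndices, Finset.mem_map, Finset.mem_univ, true_and, not_exists]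
        intro j hj
        have := congrArg Fin.val hj
        simp at this
        omega
      simp only [h1, false_iff, augment, Fin.append_left]
      intro hi
      -- Adjoin the supposedly tight old constraint: `d + 1` vectors with inner product `1` with `x`
      -- would be independent in dimension `d`.
      let f : Option (Fin d) → Fin (n + d) := fun o => o.elim (Fin.castAdd d i) (Fin.natAdd n)
      have hf : f.Injective := by
        rintro (_ | j) (_ | k) h
        · rfl
        · have := congrArg Fin.val h
          simp [f] at this
          omega
        · have := congrArg Fin.val h
          simp [f] at this
          omega
        · simpa [f] using h
      have h2 := hgp.linearIndependent_comp hf (by simp)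
      have h3 := linearIndependent_of_inner_eq_one (x := x) ?_ h2
      · have := h3.fintype_card_le_finrank
        simp at this
      · rintro (_ | j)
        · simpa [f, augment] using hi
        · simpa [f, augment] using hb j
    · simp [addedIndices, augment, hb]
  · refine ext_inner_left ℝ fun w => ?_
    have hw : w ∈ Submodule.span ℝ (Set.range b) := hspan ▸ Submodule.mem_top
    induction hw using Submodule.span_induction with
    | mem w hw =>
      obtain ⟨j, rfl⟩ := hw
      rw [hb j]
      simpa [augment] using hy (Fin.natAdd n j) (by simp [addedIndices])
    | zero => simp
    | add v w _ _ hv hw => simp [inner_add_left, hv, hw]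
    | smul t w _ hw => simp [real_inner_smul_left, hw]

theorem NoFailure.exists_isOptimal [NeZero d] {a : Fin n → Euc d} {b : Fin d → Euc d}
    {M : ℝ} {z : Euc d} (hM : 0 < M) (ha : ∀ i, ‖a i‖ ≤ M) (h : NoFailure M z b) :
    ∃ x, IsOptimal (augment a b) z x ∧ ∀ j, ⟪b j, x⟫ = 1 := by
  obtain ⟨x, hx, hMx⟩ := exists_inner_eq_one_of_le_infDist b hM h.2
  refine ⟨x, isOptimal_augment h.1 (fun i => ?_) hx, hx⟩
  calc ⟪a i, x⟫ ≤ ‖a i‖ * ‖x‖ := real_inner_le_norm _ _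
    _ ≤ M * ‖x‖ := by gcongr; exact ha i
    _ ≤ 1 := hMx

/-! ### Geometry of the regular simplex -/

/-- The component of `x` orthogonal to the unit vector `z`. -/
noncomputable def perpPart {d : ℕ} (z x : Euc d) : Euc d := x - ⟪z, x⟫ • z

section perpPart

variable {d : ℕ} {z : Euc d}

theorem inner_perpPart_self (hz : ‖z‖ = 1) (x : Euc d) : ⟪z, perpPart z x⟫ = 0 := by
  rw [perpPart, inner_sub_right, inner_smul_right, real_inner_self_eq_norm_sq, hz]
  ring

theorem norm_perpPart_sq (hz : ‖z‖ = 1) (x : Euc d) :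
    ‖perpPart z x‖ ^ 2 = ‖x‖ ^ 2 - ⟪z, x⟫ ^ 2 := by
  rw [perpPart, norm_sub_sq_real, inner_smul_right, norm_smul, hz, real_inner_comm, Real.norm_eq_abs,
    mul_one, sq_abs]
  ring

theorem inner_perpPart_left_of_inner_eq_zero {y : Euc d} (hy : ⟪z, y⟫ = 0) (x : Euc d) :
    ⟪perpPart z x, y⟫ = ⟪x, y⟫ := by
  rw [perpPart, inner_sub_left, real_inner_smul_left, hy, mul_zero, sub_zero]

end perpPart

namespace IsRegularSimplex

variable {d : ℕ} {z : Euc d} {v : Fin d → Euc d} {r : ℝ}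

theorem sum_sub_center (h : IsRegularSimplex z v r) : ∑ j, (v j - z) = 0 := by
  have hd : d ≠ 0 := by
    rintro rfl
    simpa [Subsingleton.elim z 0] using h.norm_center
  have : (d : ℝ) ≠ 0 := by exact_mod_cast hd
  rw [Finset.sum_sub_distrib, Finset.sum_const, Finset.card_univ, Fintype.card_fin,
    ← Nat.cast_smul_eq_nsmul ℝ, sub_eq_zero]
  conv_rhs => rw [← h.center]
  rw [smul_smul, mul_inv_cancel₀ this, one_smul]

/-- Regularity makes all off-diagonal Gram entries equal, and each row of the Gram matrix sums to
zero because the centered vertices do. -/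
theorem inner_sub_center (hd : 2 ≤ d) (h : IsRegularSimplex z v r) {i j : Fin d} (hij : i ≠ j) :
    ⟪v i - z, v j - z⟫ = -(r ^ 2 / (d - 1)) := by
  obtain ⟨s, hs⟩ := h.regular
  have hn : ∀ i, ‖v i - z‖ = r := fun i => by rw [norm_sub_rev]; exact h.radius i
  have h1 : ∀ i j, i ≠ j → ⟪v i - z, v j - z⟫ = (2 * r ^ 2 - s ^ 2) / 2 := by
    intro i j hij
    have := norm_sub_sq_real (v i - z) (v j - z)
    rw [sub_sub_sub_cancel_right, hs i j hij, hn, hn] at this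
    linarith
  have h2 : ∑ j, ⟪v i - z, v j - z⟫ = 0 := by
    rw [← inner_sum, h.sum_sub_center, inner_zero_right]
  rw [← Finset.add_sum_erase _ _ (Finset.mem_univ i),
    Finset.sum_congr rfl fun j hj => h1 i j (Finset.ne_of_mem_erase hj).symm,
    real_inner_self_eq_norm_sq, hn, Finset.sum_const, Finset.card_erase_of_mem (Finset.mem_univ _),
    Finset.card_univ, Fintype.card_fin, nsmul_eq_mul, Nat.cast_sub (by omega), Nat.cast_one] at h2
  rw [h1 i j hij]
  have : (2 : ℝ) ≤ d := by exact_mod_cast hd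
  rw [eq_neg_iff_add_eq_zero, ← mul_right_inj' (show (d : ℝ) - 1 ≠ 0 by linarith), mul_zero,
    mul_add, mul_div_cancel₀ _ (show (d : ℝ) - 1 ≠ 0 by linarith)]
  linarith

/-- The vertices of a regular simplex form, after a translation along the normal and a dilation,
an orthonormal basis. -/
theorem exists_orthonormalBasis (hd : 2 ≤ d) (hr : 0 < r) (h : IsRegularSimplex z v r) :
    ∃ e : OrthonormalBasis (Fin d) ℝ (Euc d), ∃ ρ τ : ℝ, ρ ^ 2 = r ^ 2 * d / (d - 1) ∧
      τ ^ 2 = r ^ 2 / (d - 1) ∧ ∀ j, ρ • e j = (v j - z) + τ • z := by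
  have hd' : (2 : ℝ) ≤ d := by exact_mod_cast hd
  have hd1 : (0 : ℝ) < d - 1 := by linarith
  have : NeZero d := ⟨by omega⟩
  set ρ := √(r ^ 2 * d / (d - 1)) with hρ
  -- The shift by `τ • z` adds `τ ^ 2` to every Gram entry, which cancels the off-diagonal ones and
  -- turns the diagonal into `ρ ^ 2`.
  set τ := √(r ^ 2 / (d - 1)) with hτ
  have hρ2 : ρ ^ 2 = r ^ 2 * d / (d - 1) := Real.sq_sqrt (by positivity)
  have hτ2 : τ ^ 2 = r ^ 2 / (d - 1) := Real.sq_sqrt (by positivity)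
  have hρ0 : 0 < ρ := Real.sqrt_pos.2 (by positivity)
  have hn : ∀ i, ‖v i - z‖ = r := fun i => by rw [norm_sub_rev]; exact h.radius i
  have hi : ∀ i j, ⟪(v i - z) + τ • z, (v j - z) + τ • z⟫ = ⟪v i - z, v j - z⟫ + τ ^ 2 := by
    intro i j
    rw [inner_add_left, inner_add_right, inner_add_right, real_inner_smul_left,
      real_inner_smul_left, inner_smul_right, inner_smul_right, h.normal, real_inner_comm z,
      h.normal, real_inner_self_eq_norm_sq, h.norm_center]
    ring
  have ho : Orthonormal ℝ fun j => ρ⁻¹ • ((v j - z) + τ • z) := by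
    rw [orthonormal_iff_ite]
    intro i j
    rw [real_inner_smul_left, inner_smul_right, hi]
    split_ifs with hij
    · subst hij
      rw [real_inner_self_eq_norm_sq, hn, hτ2]
      have : r ^ 2 + r ^ 2 / (d - 1) = ρ ^ 2 := by rw [hρ2]; field_simp; ring
      rw [this]
      field_simp
    · rw [h.inner_sub_center hd hij, hτ2]
      ring
  refine ⟨(basisOfOrthonormalOfCardEqFinrank ho (by simp)).toOrthonormalBasis (by simpa using ho),
    ρ, τ, hρ2, hτ2, fun j => ?_⟩
  simp [smul_smul, ← mul_assoc, mul_inv_cancel₀ hρ0.ne']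

/-- Parseval in the basis attached to the simplex: a vector orthogonal to `z` does not see the shift
along `z`. -/
theorem sum_inner_sq (hd : 2 ≤ d) (hr : 0 < r) (h : IsRegularSimplex z v r) {θ : Euc d}
    (hθ : ⟪θ, z⟫ = 0) : ∑ j, ⟪θ, v j - z⟫ ^ 2 = r ^ 2 * d / (d - 1) * ‖θ‖ ^ 2 := by
  obtain ⟨e, ρ, τ, hρ, -, he⟩ := h.exists_orthonormalBasis hd hr
  rw [← hρ, ← e.sum_sq_inner_left θ, Finset.mul_sum]
  refine Finset.sum_congr rfl fun j _ => ?_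
  have : ⟪θ, ρ • e j⟫ = ⟪θ, v j - z⟫ := by
    rw [he, inner_add_right, inner_smul_right, hθ, mul_zero, add_zero]
  rw [← this, inner_smul_right, mul_pow]

/-- In the same basis the shifted combination has squared norm `ρ ^ 2 * ∑ j, μ j ^ 2`; Pythagoras
removes the component along `z`. -/
theorem norm_sum_smul_sq (hd : 2 ≤ d) (hr : 0 < r) (h : IsRegularSimplex z v r) (μ : Fin d → ℝ) :
    ‖∑ j, μ j • (v j - z)‖ ^ 2 = r ^ 2 * (d * ∑ j, μ j ^ 2 - (∑ j, μ j) ^ 2) / (d - 1) := by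
  obtain ⟨e, ρ, τ, hρ, hτ, he⟩ := h.exists_orthonormalBasis hd hr
  have h1 : ∑ j, (μ j * ρ) • e j = ∑ j, μ j • (v j - z) + (τ * ∑ j, μ j) • z := by
    simp_rw [mul_smul, he, smul_add, Finset.sum_add_distrib, ← smul_comm τ, ← Finset.smul_sum,
      ← Finset.sum_smul]
  have h2 : ‖∑ j, (μ j * ρ) • e j‖ ^ 2 = ρ ^ 2 * ∑ j, μ j ^ 2 := by
    rw [← e.sum_sq_inner_right, Finset.mul_sum]
    refine Finset.sum_congr rfl fun j _ => ?_
    rw [e.orthonormal.inner_right_fintype]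
    ring
  have h3 : ⟪∑ j, μ j • (v j - z), (τ * ∑ j, μ j) • z⟫ = 0 := by
    rw [inner_smul_right, sum_inner]
    refine mul_eq_zero_of_right _ (Finset.sum_eq_zero fun j _ => ?_)
    rw [real_inner_smul_left, real_inner_comm, h.normal, mul_zero]
  rw [h1, norm_add_sq_real, h3, norm_smul, h.norm_center, Real.norm_eq_abs, mul_one, sq_abs,
    mul_pow, hρ, hτ] at h2
  have hd' : (2 : ℝ) ≤ d := by exact_mod_cast hd
  have hd1 : (d : ℝ) - 1 ≠ 0 := by linarith
  field_simp at h2 ⊢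
  linarith

end IsRegularSimplex

/-! ### Small noise excludes failure -/

/-- If `x` has sum zero and `x j + q j > 0` for all `j`, then `q` is not too small. -/
theorem sum_sq_lt_of_forall_add_pos {ι : Type*} [Fintype ι] [Nonempty ι] {x q : ι → ℝ}
    (hx : ∑ j, x j = 0) (hq : ∀ j, 0 < x j + q j) :
    ∑ j, x j ^ 2 < Fintype.card ι * ∑ j, q j ^ 2 := by
  classical
  obtain ⟨j₀, hj₀⟩ : ∃ j, 0 ≤ x j := by
    by_contra! H
    exact (Finset.sum_neg (fun j _ => H j) Finset.univ_nonempty).ne hx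
  obtain ⟨j₁, hj₁⟩ : ∃ j, x j ≤ 0 := by
    by_contra! H
    exact (Finset.sum_pos (fun j _ => H j) Finset.univ_nonempty).ne' hx
  set p : ι → ℝ := fun j => max (x j) 0
  set m : ι → ℝ := fun j => max (-x j) 0
  have hpm : ∀ j, x j = p j - m j := fun j => by
    simp only [p, m]
    rcases le_total 0 (x j) with h | h
    · rw [max_eq_left h, max_eq_right (by linarith)]; ring
    · rw [max_eq_right h, max_eq_left (by linarith)]; ring
  have hsq : ∀ j, x j ^ 2 = p j ^ 2 + m j ^ 2 := fun j => by
    simp only [p, m]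
    rcases le_total 0 (x j) with h | h
    · rw [max_eq_left h, max_eq_right (by linarith)]; ring
    · rw [max_eq_right h, max_eq_left (by linarith)]; ring
  have hp0 : ∀ j, 0 ≤ p j := fun j => le_max_right _ _
  have hmq : ∀ j, m j ^ 2 ≤ q j ^ 2 := fun j => by
    simp only [m]
    rcases le_total 0 (x j) with h | h
    · rw [max_eq_right (by linarith)]; simpa using sq_nonneg (q j)
    · rw [max_eq_left (by linarith)]
      exact pow_le_pow_left₀ (by linarith) (by linarith [hq j]) 2
  have hmq1 : m j₁ ^ 2 < q j₁ ^ 2 := by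
    simp only [m]
    rw [max_eq_left (by linarith)]
    exact pow_lt_pow_left₀ (by linarith [hq j₁]) (by linarith) two_ne_zero
  have hsum : ∑ j, p j = ∑ j, m j := by
    have : ∑ j, x j = ∑ j, p j - ∑ j, m j := by
      rw [← Finset.sum_sub_distrib]; exact Finset.sum_congr rfl fun j _ => hpm j
    linarith
  have hmj₀ : m j₀ = 0 := max_eq_right (by linarith)
  have h1 : ∑ j, p j ^ 2 ≤ (∑ j, m j) ^ 2 := by
    rw [← hsum]
    exact Finset.sum_sq_le_sq_sum_of_nonneg fun j _ => hp0 j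
  have h2 : (∑ j, m j) ^ 2 ≤ (Fintype.card ι - 1 : ℝ) * ∑ j, m j ^ 2 := by
    -- Since `m` vanishes at `j₀`, Cauchy–Schwarz costs only `card ι - 1`; the saved unit absorbs
    -- the term `∑ j, m j ^ 2` of `h3`.
    rw [← Finset.add_sum_erase _ _ (Finset.mem_univ j₀),
      ← Finset.add_sum_erase _ (fun j => m j ^ 2) (Finset.mem_univ j₀), hmj₀]
    have := sq_sum_le_card_mul_sum_sq (s := Finset.univ.erase j₀) (f := m)
    rw [Finset.card_erase_of_mem (Finset.mem_univ _), Finset.card_univ,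
      Nat.cast_sub Fintype.card_pos, Nat.cast_one] at this
    simpa using this
  have h3 : ∑ j, x j ^ 2 = ∑ j, p j ^ 2 + ∑ j, m j ^ 2 := by
    rw [← Finset.sum_add_distrib]; exact Finset.sum_congr rfl fun j _ => hsq j
  have h4 : ∑ j, m j ^ 2 < ∑ j, q j ^ 2 :=
    Finset.sum_lt_sum (fun j _ => hmq j) ⟨j₁, Finset.mem_univ _, hmq1⟩
  have h5 : (0 : ℝ) < Fintype.card ι := by exact_mod_cast Fintype.card_pos
  nlinarith

/-- The noise `σ g` is small in comparison to a simplex of radius `r` with normal `z`, both in the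
directions orthogonal to `z` and in the direction of `z`. -/
def SmallNoise {d : ℕ} (z : Euc d) (σ r : ℝ) (g : Fin d → Euc d) : Prop :=
  σ ^ 2 * ∑ j, (‖g j‖ ^ 2 - ⟪z, g j⟫ ^ 2) ≤ r ^ 2 / (d - 1) ∧
    σ ^ 2 * ∑ j, ⟪z, g j⟫ ^ 2 ≤ r ^ 2 / 2

section SmallNoise

variable {d : ℕ} {z : Euc d} {v g : Fin d → Euc d} {σ r : ℝ}

/-- Otherwise some `θ` orthogonal to `z` is positive on all projected vertices. Then
`sum_sq_lt_of_forall_add_pos` forces the noise in direction `θ` above `r ^ 2 / (d - 1) * ‖θ‖ ^ 2`,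
exactly the threshold in `SmallNoise`. -/
theorem exists_mem_stdSimplex_of_smallNoise (hd : 2 ≤ d) (hr : 0 < r)
    (h : IsRegularSimplex z v r) (hg : SmallNoise z σ r g) :
    ∃ t ∈ stdSimplex ℝ (Fin d), ∑ j, t j • ((v j - z) + σ • perpPart z (g j)) = 0 := by
  have : NeZero d := ⟨by omega⟩
  set y : Fin d → Euc d := fun j => (v j - z) + σ • perpPart z (g j)
  have hyz : ∀ j, ⟪z, y j⟫ = 0 := fun j => by
    simp only [y]
    rw [inner_add_right, h.normal, inner_smul_right, inner_perpPart_self h.norm_center]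
    ring
  let f : (Fin d → ℝ) →ₗ[ℝ] Euc d := Fintype.linearCombination ℝ y
  by_contra! H
  have h0 : (0 : Euc d) ∉ f '' stdSimplex ℝ (Fin d) := by
    rintro ⟨t, ht, h0⟩
    exact H t ht (by rwa [Fintype.linearCombination_apply] at h0)
  obtain ⟨F, u, hu, hF⟩ := geometric_hahn_banach_point_closed
    ((convex_stdSimplex ℝ (Fin d)).linear_image f)
    ((isCompact_stdSimplex ℝ (Fin d)).image f.continuous_of_finiteDimensional).isClosed h0
  rw [map_zero] at hu
  set θ₀ := (InnerProductSpace.toDual ℝ (Euc d)).symm F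
  -- Every `y j` is orthogonal to `z`, so projecting the separating vector changes none of the
  -- pairings.
  set θ := perpPart z θ₀
  have hpos : ∀ j, 0 < ⟪θ, y j⟫ := fun j => by
    rw [inner_perpPart_left_of_inner_eq_zero (hyz j), InnerProductSpace.toDual_symm_apply]
    refine hu.trans (hF _ ⟨Pi.single j 1, single_mem_stdSimplex ℝ j, ?_⟩)
    simp [f, Fintype.linearCombination_apply_single]
  have hθz : ⟪θ, z⟫ = 0 := by
    rw [real_inner_comm]; exact inner_perpPart_self h.norm_center _
  have h1 := sum_sq_lt_of_forall_add_pos (x := fun j => ⟪θ, v j - z⟫)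
    (q := fun j => σ * ⟪θ, perpPart z (g j)⟫)
    (by rw [← inner_sum, h.sum_sub_center, inner_zero_right])
    (fun j => by simpa [y, inner_add_right, inner_smul_right] using hpos j)
  rw [h.sum_inner_sq hd hr hθz, Fintype.card_fin] at h1
  have h2 : ∑ j, (σ * ⟪θ, perpPart z (g j)⟫) ^ 2 ≤ ‖θ‖ ^ 2 * (r ^ 2 / (d - 1)) := by
    calc ∑ j, (σ * ⟪θ, perpPart z (g j)⟫) ^ 2
        ≤ ∑ j, ‖θ‖ ^ 2 * (σ ^ 2 * (‖g j‖ ^ 2 - ⟪z, g j⟫ ^ 2)) := by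
          refine Finset.sum_le_sum fun j _ => ?_
          rw [← norm_perpPart_sq h.norm_center, mul_pow]
          have := sq_le_sq' (neg_le_of_abs_le (abs_real_inner_le_norm θ (perpPart z (g j))))
            (real_inner_le_norm θ (perpPart z (g j)))
          rw [mul_pow] at this
          nlinarith [sq_nonneg σ]
      _ = ‖θ‖ ^ 2 * (σ ^ 2 * ∑ j, (‖g j‖ ^ 2 - ⟪z, g j⟫ ^ 2)) := by
          rw [← Finset.mul_sum, ← Finset.mul_sum]
      _ ≤ _ := by gcongr; exact hg.1
  have h3 : (d : ℝ) * ∑ j, (σ * ⟪θ, perpPart z (g j)⟫) ^ 2 ≤ r ^ 2 * d / (d - 1) * ‖θ‖ ^ 2 := by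
    calc _ ≤ (d : ℝ) * (‖θ‖ ^ 2 * (r ^ 2 / (d - 1))) := by gcongr
      _ = _ := by ring
  linarith

theorem abs_inner_lt_one_of_smallNoise (hr1 : r ≤ 1 / 200) (hr : 0 < r)
    (hg : SmallNoise z σ r g) (j : Fin d) : |σ * ⟪z, g j⟫| < 1 := by
  rw [← sq_lt_one_iff_abs_lt_one, mul_pow]
  have h1 : ⟪z, g j⟫ ^ 2 ≤ ∑ j, ⟪z, g j⟫ ^ 2 :=
    Finset.single_le_sum (f := fun j => ⟪z, g j⟫ ^ 2) (fun _ _ => sq_nonneg _) (Finset.mem_univ j)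
  have h2 := hg.2
  have h3 : σ ^ 2 * ⟪z, g j⟫ ^ 2 ≤ σ ^ 2 * ∑ j, ⟪z, g j⟫ ^ 2 := by gcongr
  nlinarith

/-- With small noise, the center of the simplex is in the cone of the smoothed vertices. -/
theorem mem_cone_of_smallNoise (hd : 2 ≤ d) (hr : 0 < r) (hr1 : r ≤ 1 / 200)
    (h : IsRegularSimplex z v r) (hg : SmallNoise z σ r g) :
    z ∈ cone fun j => v j + σ • g j := by
  obtain ⟨t, ht, hty⟩ := exists_mem_stdSimplex_of_smallNoise hd hr h hg
  -- Split each vertex into its height along `z` and an orthogonal part. The weights `t` cancel the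
  -- orthogonal parts, and the heights are positive, so a positive multiple of `z` remains.
  have hb : ∀ j, v j + σ • g j
      = (1 + σ * ⟪z, g j⟫) • z + ((v j - z) + σ • perpPart z (g j)) := fun j => by
    rw [perpPart]
    module
  have h1 : ∑ j, t j • (v j + σ • g j) = (∑ j, t j * (1 + σ * ⟪z, g j⟫)) • z := by
    simp_rw [hb, smul_add _ (_ • z), Finset.sum_add_distrib, hty, add_zero, smul_smul,
      Finset.sum_smul]
  have hpos : ∀ j, 0 < 1 + σ * ⟪z, g j⟫ := fun j => by
    have := (abs_lt.1 (abs_inner_lt_one_of_smallNoise hr1 hr hg j)).1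
    linarith
  set s := ∑ j, t j * (1 + σ * ⟪z, g j⟫) with hs
  have hs0 : 0 < s := by
    obtain ⟨j, hj⟩ : ∃ j, 0 < t j := by
      by_contra! H
      have := ht.2
      have h0 : ∑ j, t j ≤ 0 := Finset.sum_nonpos fun j _ => H j
      linarith
    exact Finset.sum_pos' (fun j _ => mul_nonneg (ht.1 j) (hpos j).le)
      ⟨j, Finset.mem_univ _, mul_pos hj (hpos j)⟩
  refine ⟨fun j => s⁻¹ * t j, fun j => mul_nonneg (inv_nonneg.2 hs0.le) (ht.1 j), ?_⟩
  simp_rw [mul_smul, ← Finset.smul_sum, h1, smul_smul, inv_mul_cancel₀ hs0.ne', one_smul]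

/-- The difference `a - b` is at least `√q * (√(t + 0.999) - 1) / √t`, whose worst case is `t = 1`.
There the factor exceeds `0.409`, and `0.409 ^ 2 > 1 / 6`. -/
theorem sq_div_six_le_sq_of_sub_le {a b c q t : ℝ} (ht : 1 ≤ t) (ha : 0 ≤ a) (hb : 0 ≤ b)
    (hq : 0 ≤ q) (hbq : t * b ^ 2 ≤ q) (haq : (t + 999 / 1000) * q ≤ t * a ^ 2)
    (habc : a - b ≤ c) : q / 6 ≤ c ^ 2 := by
  set R := √q
  have hR0 : 0 ≤ R := Real.sqrt_nonneg _
  have hR2 : R ^ 2 = q := Real.sq_sqrt hq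
  set s := √t
  have hs2 : s ^ 2 = t := Real.sq_sqrt (by linarith)
  have hs1 : 1 ≤ s := Real.one_le_sqrt.2 ht
  have hsb : s * b ≤ R := by
    refine (sq_le_sq₀ (by positivity) hR0).1 ?_
    rw [mul_pow, hs2, hR2]; exact hbq
  have hsa : R * (1 + 409 / 1000 * s) ≤ s * a := by
    refine (sq_le_sq₀ (by positivity) (by positivity)).1 ?_
    have h1 : (1 + 409 / 1000 * s) ^ 2 ≤ t + 999 / 1000 := by nlinarith
    rw [mul_pow, mul_pow, hR2]
    calc q * (1 + 409 / 1000 * s) ^ 2 ≤ q * (t + 999 / 1000) := by gcongr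
      _ ≤ _ := by rw [hs2]; linarith
  have hab : 409 / 1000 * R ≤ a - b := by
    refine le_of_mul_le_mul_left ?_ (lt_of_lt_of_le one_pos hs1)
    linarith
  have := pow_le_pow_left₀ (by positivity) (hab.trans habc) 2
  rw [mul_pow, hR2] at this
  linarith

/-- With small noise, the affine hull of the smoothed vertices stays away from the origin. -/
theorem half_le_norm_of_smallNoise (hd : 2 ≤ d) (hr : 0 < r) (hr1 : r ≤ 1 / 200)
    (h : IsRegularSimplex z v r) (hg : SmallNoise z σ r g) {μ : Fin d → ℝ} (hμ : ∑ j, μ j = 1) :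
    1 / 2 ≤ ‖∑ j, μ j • (v j + σ • g j)‖ := by
  have hd' : (2 : ℝ) ≤ d := by exact_mod_cast hd
  have hd1 : (0 : ℝ) < d - 1 := by linarith
  set A := ∑ j, μ j • (v j - z) with hA
  set B := ∑ j, μ j • σ • perpPart z (g j) with hB
  set w := σ * ∑ j, μ j * ⟪z, g j⟫ with hw
  have hsum : ∑ j, μ j • (v j + σ • g j) = (1 + w) • z + (A + B) := by
    rw [hA, hB, ← Finset.sum_add_distrib, hw, ← hμ, Finset.mul_sum, ← Finset.sum_add_distrib,
      Finset.sum_smul, ← Finset.sum_add_distrib]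
    refine Finset.sum_congr rfl fun j _ => ?_
    rw [perpPart]
    module
  have hzAB : ⟪z, A + B⟫ = 0 := by
    simp [hA, hB, inner_add_right, inner_sum, inner_smul_right, h.normal,
      inner_perpPart_self h.norm_center]
  have hnorm : ‖∑ j, μ j • (v j + σ • g j)‖ ^ 2 = (1 + w) ^ 2 + ‖A + B‖ ^ 2 := by
    rw [hsum, norm_add_sq_real, real_inner_smul_left, hzAB, norm_smul, h.norm_center,
      Real.norm_eq_abs, mul_one, sq_abs]
    ring
  set m2 := ∑ j, μ j ^ 2 with hm2
  have hm20 : 0 ≤ m2 := Finset.sum_nonneg fun _ _ => sq_nonneg _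
  have hw2 : w ^ 2 ≤ r ^ 2 * m2 / 2 := by
    have h1 := Finset.sum_mul_sq_le_sq_mul_sq Finset.univ μ (fun j => ⟪z, g j⟫)
    have h2 := hg.2
    calc w ^ 2 ≤ σ ^ 2 * (m2 * ∑ j, ⟪z, g j⟫ ^ 2) := by
          rw [hw, mul_pow]; gcongr
      _ = m2 * (σ ^ 2 * ∑ j, ⟪z, g j⟫ ^ 2) := by ring
      _ ≤ m2 * (r ^ 2 / 2) := by gcongr
      _ = _ := by ring
  have hB2 : (d - 1) * ‖B‖ ^ 2 ≤ r ^ 2 * m2 := by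
    have h1 : ‖B‖ ≤ ∑ j, |μ j| * (|σ| * ‖perpPart z (g j)‖) := by
      refine (norm_sum_le _ _).trans (Finset.sum_le_sum fun j _ => ?_)
      rw [norm_smul, norm_smul, Real.norm_eq_abs, Real.norm_eq_abs]
    have h2 := Finset.sum_mul_sq_le_sq_mul_sq Finset.univ (fun j => |μ j|)
      (fun j => |σ| * ‖perpPart z (g j)‖)
    simp only [mul_pow, sq_abs, ← Finset.mul_sum, norm_perpPart_sq h.norm_center] at h2
    have h3 := pow_le_pow_left₀ (norm_nonneg _) h1 2
    have h4 := hg.1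
    rw [le_div_iff₀ hd1] at h4
    calc (d - 1) * ‖B‖ ^ 2 ≤ (d - 1) * (m2 * (σ ^ 2 * ∑ j, (‖g j‖ ^ 2 - ⟪z, g j⟫ ^ 2))) := by
          gcongr; exact h3.trans h2
      _ = m2 * ((σ ^ 2 * ∑ j, (‖g j‖ ^ 2 - ⟪z, g j⟫ ^ 2)) * (d - 1)) := by ring
      _ ≤ m2 * r ^ 2 := by gcongr
      _ = _ := by ring
  have hA2 : (d - 1) * ‖A‖ ^ 2 = r ^ 2 * (d * m2 - 1) := by
    rw [hA, h.norm_sum_smul_sq hd hr, hμ]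
    rw [mul_div_cancel₀ _ hd1.ne', one_pow]
  refine (sq_le_sq₀ (by norm_num) (norm_nonneg _)).1 ?_
  rw [hnorm]
  by_cases hwh : w ^ 2 ≤ 1 / 4
  · have : |w| ≤ 1 / 2 := abs_le_of_sq_le_sq (by linarith) (by norm_num)
    have := (abs_le.1 this).1
    nlinarith [sq_nonneg ‖A + B‖]
  -- Now `|w| > 1 / 2`, so `m2` is huge and the `-1` in `hA2` costs less than `m2 / 1000`; hence the
  -- slack `999 / 1000`.
  have hm1 : 1 ≤ 2 * r ^ 2 * m2 := by linarith [not_le.1 hwh]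
  have hr2 : r ^ 2 ≤ 1 / 40000 := by nlinarith
  have hm1' : 1 ≤ m2 / 1000 := by nlinarith
  have hAB : ‖A‖ - ‖B‖ ≤ ‖A + B‖ := by
    have := norm_sub_le (A + B) B
    rw [add_sub_cancel_right] at this
    linarith
  have hAB2 := sq_div_six_le_sq_of_sub_le (t := d - 1) (by linarith) (norm_nonneg A)
    (norm_nonneg B) (q := r ^ 2 * m2) (by positivity) hB2
    (by rw [hA2]; nlinarith) hAB
  -- Here `‖A + B‖ ^ 2 ≥ r ^ 2 * m2 / 6 ≥ w ^ 2 / 3`, and `(1 + w) ^ 2 + w ^ 2 / 3` has minimum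
  -- exactly `1 / 4`, at `w = -3 / 4`.
  nlinarith [sq_nonneg (w + 3 / 4)]

end SmallNoise

/-! ### Moments and tails of Gaussian vectors -/

theorem integral_sq_gaussianReal : ∫ x, x ^ 2 ∂(gaussianReal 0 1) = 1 := by
  have h := variance_id_gaussianReal (μ := 0) (v := 1)
  rw [variance_eq_integral (by fun_prop)] at h
  simpa using h

/-- The value is the fourth derivative at `0` of the moment generating function `exp (t ^ 2 / 2)`.
-/
theorem integral_pow_four_gaussianReal : ∫ x, x ^ 4 ∂(gaussianReal 0 1) = 3 := by
  have h0 : (0 : ℝ) ∈ interior (integrableExpSet id (gaussianReal 0 1)) := by simp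
  have h := iteratedDeriv_mgf_zero h0 4
  have hE : ∀ t : ℝ, HasDerivAt (fun t : ℝ => Real.exp (t ^ 2 / 2)) (t * Real.exp (t ^ 2 / 2)) t := by
    intro t
    convert (((hasDerivAt_id' t).fun_pow 2).div_const 2).exp using 1
    norm_num
    ring
  have h1 : deriv (fun t : ℝ => Real.exp (t ^ 2 / 2)) = fun t => t * Real.exp (t ^ 2 / 2) :=
    funext fun t => (hE t).deriv
  have h2 : deriv (fun t : ℝ => t * Real.exp (t ^ 2 / 2))
      = fun t => (1 + t ^ 2) * Real.exp (t ^ 2 / 2) := funext fun t => by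
    rw [((hasDerivAt_id' t).fun_mul (hE t)).deriv]; ring
  have h3 : deriv (fun t : ℝ => (1 + t ^ 2) * Real.exp (t ^ 2 / 2))
      = fun t => (3 * t + t ^ 3) * Real.exp (t ^ 2 / 2) := funext fun t => by
    rw [((((hasDerivAt_id' t).fun_pow 2).const_add 1).fun_mul (hE t)).deriv]; norm_num; ring
  have h4 : deriv (fun t : ℝ => (3 * t + t ^ 3) * Real.exp (t ^ 2 / 2))
      = fun t => (3 + 6 * t ^ 2 + t ^ 4) * Real.exp (t ^ 2 / 2) := funext fun t => by
    rw [((((hasDerivAt_id' t).const_mul 3).fun_add ((hasDerivAt_id' t).fun_pow 3)).fun_mul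
      (hE t)).deriv]
    norm_num; ring
  rw [mgf_id_gaussianReal] at h
  simp only [NNReal.coe_one, zero_mul, zero_add, one_mul, iteratedDeriv_succ, iteratedDeriv_zero,
    h1, h2, h3, h4] at h
  simpa using h.symm

theorem memLp_sq_gaussianReal : MemLp (fun x => x ^ 2) 2 (gaussianReal 0 1) := by
  rw [memLp_two_iff_integrable_sq (by fun_prop)]
  have := (memLp_id_gaussianReal (μ := 0) (v := 1) 4).integrable_norm_pow (by norm_num)
  refine this.congr (ae_of_all _ fun x => ?_)
  simp only [id, Real.norm_eq_abs]
  rw [← pow_mul]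
  exact (by decide : Even 4).pow_abs x

theorem variance_sq_gaussianReal : Var[fun x => x ^ 2; gaussianReal 0 1] = 2 := by
  rw [variance_eq_sub memLp_sq_gaussianReal, integral_sq_gaussianReal]
  have : ((fun x : ℝ => x ^ 2) ^ 2) = fun x : ℝ => x ^ 4 := by
    ext x; simp only [Pi.pow_apply]; ring
  rw [this, integral_pow_four_gaussianReal]
  norm_num

/-- The density is at most `1 / √(2π) < 2 / 5`, on an interval of length `2 * t`. -/
theorem gaussianReal_abs_le (t : ℝ) :
    gaussianReal 0 1 {x | |x| ≤ t} ≤ ENNReal.ofReal (4 / 5 * t) := by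
  have hset : {x : ℝ | |x| ≤ t} = Set.Icc (-t) t := by
    ext x; simp [abs_le]
  have hpdf : ∀ x, gaussianPDF 0 1 x ≤ ENNReal.ofReal (2 / 5) := fun x => by
    rw [gaussianPDF, gaussianPDFReal]
    refine ENNReal.ofReal_le_ofReal ?_
    have h1 : (5 / 2 : ℝ) ≤ √(2 * Real.pi * (1 : NNReal)) := by
      refine Real.le_sqrt_of_sq_le ?_
      have := Real.pi_gt_d2
      norm_num
      linarith
    have h2 : (√(2 * Real.pi * (1 : NNReal)))⁻¹ ≤ 2 / 5 := by
      rw [show (2 / 5 : ℝ) = (5 / 2)⁻¹ by norm_num]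
      exact inv_anti₀ (by norm_num) h1
    have h3 : Real.exp (-(x - 0) ^ 2 / (2 * (1 : NNReal))) ≤ 1 := by
      rw [Real.exp_le_one_iff]
      have := sq_nonneg (x - 0)
      simp only [NNReal.coe_one, mul_one]
      linarith
    calc _ ≤ 2 / 5 * (1 : ℝ) := by gcongr
      _ = _ := by norm_num
  rw [gaussianReal_apply _ one_ne_zero, hset]
  calc ∫⁻ x in Set.Icc (-t) t, gaussianPDF 0 1 x
      ≤ ∫⁻ _ in Set.Icc (-t) t, ENNReal.ofReal (2 / 5) := lintegral_mono fun x => hpdf x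
    _ = ENNReal.ofReal (4 / 5 * t) := by
      rw [setLIntegral_const, Real.volume_Icc, ← ENNReal.ofReal_mul (by norm_num)]
      congr 1; ring

theorem gaussianReal_le_abs {t : ℝ} (ht : 0 ≤ t) :
    gaussianReal 0 1 {x | t ≤ |x|} ≤ ENNReal.ofReal (2 * Real.exp (-t ^ 2 / 2)) := by
  have hs : HasSubgaussianMGF id 1 (gaussianReal 0 1) := by
    refine ⟨fun s => integrable_exp_mul_gaussianReal s, fun s => ?_⟩
    rw [mgf_id_gaussianReal]
    simp
  have h1 := hs.measure_ge_le ht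
  have h2 := hs.neg.measure_ge_le ht
  simp only [NNReal.coe_one, mul_one, id, Pi.neg_apply] at h1 h2
  have hsub : {x : ℝ | t ≤ |x|} ⊆ {x | t ≤ x} ∪ {x | t ≤ -x} := fun x hx => by
    simpa [le_abs] using hx
  rw [← ENNReal.ofReal_toReal (measure_ne_top (gaussianReal 0 1) {x | t ≤ |x|})]
  refine ENNReal.ofReal_le_ofReal ?_
  calc (gaussianReal 0 1).real {x | t ≤ |x|}
      ≤ (gaussianReal 0 1).real ({x | t ≤ x} ∪ {x | t ≤ -x}) := measureReal_mono hsub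
    _ ≤ _ := measureReal_union_le _ _
    _ ≤ _ := by linarith

theorem lintegral_Ici_mul_exp {s : ℝ} (hs : 0 ≤ s) :
    ∫⁻ r in Set.Ici s, ENNReal.ofReal (r * Real.exp (-r ^ 2 / 2))
      = ENNReal.ofReal (Real.exp (-s ^ 2 / 2)) := by
  rw [setLIntegral_congr Ioi_ae_eq_Ici.symm]
  have hderiv : ∀ x ∈ Set.Ici s,
      HasDerivAt (fun r => -Real.exp (-r ^ 2 / 2)) (x * Real.exp (-x ^ 2 / 2)) x := by
    intro x _
    refine ((((hasDerivAt_id' x).fun_pow 2).fun_neg.div_const 2).exp).fun_neg.congr_deriv ?_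
    norm_num
    ring
  have hpos : ∀ x ∈ Set.Ioi s, 0 ≤ x * Real.exp (-x ^ 2 / 2) := fun x hx =>
    mul_nonneg (hs.trans (le_of_lt hx)) (Real.exp_pos _).le
  have hlim : Filter.Tendsto (fun r : ℝ => -Real.exp (-r ^ 2 / 2)) Filter.atTop (nhds 0) := by
    rw [← neg_zero]
    refine (Real.tendsto_exp_atBot.comp ?_).neg
    have : (fun r : ℝ => -r ^ 2 / 2) = fun r => -(r ^ 2 / 2) := by ext; ring
    rw [this]
    exact Filter.tendsto_neg_atTop_atBot.comp
      ((Filter.tendsto_pow_atTop two_ne_zero).atTop_div_const two_pos)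
  rw [← ofReal_integral_eq_lintegral_ofReal
    (integrableOn_Ioi_deriv_of_nonneg' hderiv hpos hlim)
    ((ae_restrict_iff' measurableSet_Ioi).2 (ae_of_all _ hpos)),
    integral_Ioi_of_hasDerivAt_of_nonneg' hderiv hpos hlim]
  simp

/-- Polar coordinates turn the planar tail into an elementary radial integral. It serves the case `d
= 2`, where the second-moment estimates are too weak. -/
theorem prod_gaussianReal_le_sq_add_sq {t : ℝ} (ht : 0 ≤ t) :
    (gaussianReal 0 1).prod (gaussianReal 0 1) {p | t ≤ p.1 ^ 2 + p.2 ^ 2}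
      ≤ ENNReal.ofReal (Real.exp (-t / 2)) := by
  have hS : MeasurableSet {p : ℝ × ℝ | t ≤ p.1 ^ 2 + p.2 ^ 2} :=
    measurableSet_le (by fun_prop) (by fun_prop)
  have hpdf : ∀ p : ℝ × ℝ, gaussianPDF 0 1 p.1 * gaussianPDF 0 1 p.2
      = ENNReal.ofReal ((2 * Real.pi)⁻¹ * Real.exp (-(p.1 ^ 2 + p.2 ^ 2) / 2)) := fun p => by
    rw [gaussianPDF, gaussianPDF, ← ENNReal.ofReal_mul (gaussianPDFReal_nonneg _ _ _),
      gaussianPDFReal, gaussianPDFReal]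
    congr 1
    rw [mul_mul_mul_comm, ← mul_inv, ← Real.exp_add, Real.mul_self_sqrt (by positivity)]
    simp only [NNReal.coe_one, mul_one, sub_zero]
    ring_nf
  rw [gaussianReal_of_var_ne_zero _ one_ne_zero,
    prod_withDensity (measurable_gaussianPDF _ _) (measurable_gaussianPDF _ _),
    withDensity_apply _ hS, ← lintegral_indicator hS, ← Measure.volume_eq_prod,
    ← lintegral_comp_polarCoord_symm]
  have hbound : ∀ p ∈ polarCoord.target, ENNReal.ofReal p.1 •
      Set.indicator {p : ℝ × ℝ | t ≤ p.1 ^ 2 + p.2 ^ 2}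
        (fun p => gaussianPDF 0 1 p.1 * gaussianPDF 0 1 p.2) (polarCoord.symm p)
      = (Set.Ici √t).indicator (fun r => ENNReal.ofReal (r * Real.exp (-r ^ 2 / 2))) p.1
        * ENNReal.ofReal (2 * Real.pi)⁻¹ := by
    rintro ⟨r, θ⟩ hp
    have hr : 0 < r := hp.1
    have hsq : (r * Real.cos θ) ^ 2 + (r * Real.sin θ) ^ 2 = r ^ 2 := by
      rw [mul_pow, mul_pow, ← mul_add, Real.cos_sq_add_sin_sq, mul_one]
    simp only [polarCoord_symm_apply, smul_eq_mul, Set.indicator, Set.mem_ofPred_eq, Set.mem_Ici,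
      hsq]
    have hiff : t ≤ r ^ 2 ↔ √t ≤ r := (Real.sqrt_le_left hr.le).symm
    simp only [hiff]
    split_ifs
    · rw [hpdf (r * Real.cos θ, r * Real.sin θ), hsq, ← ENNReal.ofReal_mul hr.le, ← ENNReal.ofReal_mul (by positivity)]
      congr 1; ring
    · simp
  rw [setLIntegral_congr_fun polarCoord.open_target.measurableSet hbound, polarCoord_target,
    Measure.volume_eq_prod, ← Measure.prod_restrict,
    lintegral_prod_mul (f := (Set.Ici √t).indicator
      (fun r => ENNReal.ofReal (r * Real.exp (-r ^ 2 / 2))))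
      (g := fun _ => ENNReal.ofReal (2 * Real.pi)⁻¹)
      ((Measurable.indicator (by fun_prop) measurableSet_Ici).aemeasurable) (by fun_prop)]
  have h1 : ∫⁻ r in Set.Ioi 0, (Set.Ici √t).indicator
      (fun r => ENNReal.ofReal (r * Real.exp (-r ^ 2 / 2))) r ≤ ENNReal.ofReal (Real.exp (-t / 2)) := by
    refine (setLIntegral_le_lintegral _ _).trans ?_
    rw [lintegral_indicator measurableSet_Ici, lintegral_Ici_mul_exp (Real.sqrt_nonneg _),
      Real.sq_sqrt ht]
  have h2 : ∫⁻ _ in Set.Ioo (-Real.pi) Real.pi, ENNReal.ofReal (2 * Real.pi)⁻¹ = 1 := by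
    rw [setLIntegral_const, Real.volume_Ioo, ← ENNReal.ofReal_mul (by positivity),
      show (2 * Real.pi)⁻¹ * (Real.pi - -Real.pi) = 1 by field_simp; ring, ENNReal.ofReal_one]
  rw [h2, mul_one]
  exact h1

section StdGaussian

variable {d : ℕ}

theorem stdGaussian_map_orthonormalBasis (b : OrthonormalBasis (Fin d) ℝ (Euc d)) :
    MeasurePreserving (fun x i => ⟪b i, x⟫) (stdGaussian (Euc d))
      (Measure.pi fun _ : Fin d => gaussianReal 0 1) := by
  refine ⟨by fun_prop, ?_⟩
  rw [stdGaussian_eq_map_pi_orthonormalBasis b, Measure.map_map (by fun_prop) (by fun_prop)]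
  convert Measure.map_id
  ext x i
  simp [b.orthonormal.inner_right_fintype]

theorem stdGaussian_map_inner {e : Euc d} (he : ‖e‖ = 1) :
    MeasurePreserving (fun x => ⟪e, x⟫) (stdGaussian (Euc d)) (gaussianReal 0 1) := by
  refine ⟨by fun_prop, ?_⟩
  have h := IsGaussian.map_eq_gaussianReal (μ := stdGaussian (Euc d)) (innerSL ℝ e)
  rw [integral_strongDual_stdGaussian, variance_dual_stdGaussian, innerSL_apply_norm, he] at h
  simpa using! h

theorem lintegral_inner_sq_stdGaussian (x : Euc d) :
    ∫⁻ y, ENNReal.ofReal (⟪x, y⟫ ^ 2) ∂(stdGaussian (Euc d)) = ENNReal.ofReal (‖x‖ ^ 2) := by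
  have h := variance_dual_stdGaussian (innerSL ℝ x)
  rw [innerSL_apply_norm, variance_eq_integral (by fun_prop), integral_strongDual_stdGaussian] at h
  simp only [sub_zero, innerSL_apply_apply] at h
  rw [← h, ofReal_integral_eq_lintegral_ofReal _ (ae_of_all _ fun _ => sq_nonneg _)]
  have := (IsGaussian.memLp_dual (stdGaussian (Euc d)) (innerSL ℝ x) 2 (by simp)).integrable_sq
  simpa using! this

theorem lintegral_norm_sq_stdGaussian :
    ∫⁻ y, ENNReal.ofReal (‖y‖ ^ 2) ∂(stdGaussian (Euc d)) = d := by
  have h : ∀ y : Euc d, ENNReal.ofReal (‖y‖ ^ 2)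
      = ∑ i, ENNReal.ofReal (⟪EuclideanSpace.basisFun (Fin d) ℝ i, y⟫ ^ 2) := fun y => by
    rw [← ENNReal.ofReal_sum_of_nonneg fun _ _ => sq_nonneg _,
      OrthonormalBasis.sum_sq_inner_right]
  simp_rw [h]
  rw [lintegral_finsetSum _ fun _ _ => by fun_prop]
  simp [lintegral_inner_sq_stdGaussian]

theorem exists_orthonormalBasis_apply_eq {z : Euc d} (hz : ‖z‖ = 1) (i : Fin d) :
    ∃ b : OrthonormalBasis (Fin d) ℝ (Euc d), b i = z := by
  have ho : Orthonormal ℝ (({i} : Set (Fin d)).domRestrict fun _ => z) := by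
    rw [orthonormal_iff_ite]
    rintro ⟨j, hj⟩ ⟨k, hk⟩
    obtain rfl : j = i := by simpa using hj
    obtain rfl : k = j := by simpa using hk
    simp [Set.domRestrict, hz]
  obtain ⟨b, hb⟩ := ho.exists_orthonormalBasis_extension_of_card_eq (by simp)
  exact ⟨b, hb i (by simp)⟩

theorem norm_sq_sub_inner_sq_eq_sum (b : OrthonormalBasis (Fin d) ℝ (Euc d)) (i : Fin d)
    (x : Euc d) : ‖x‖ ^ 2 - ⟪b i, x⟫ ^ 2
      = ∑ k, (if k = i then 0 else 1) * ⟪b k, x⟫ ^ 2 := by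
  rw [← b.sum_sq_inner_right x, ← Finset.add_sum_erase _ _ (Finset.mem_univ i), add_sub_cancel_left,
    ← Finset.add_sum_erase _ _ (Finset.mem_univ i)]
  simp only [if_true, zero_mul, zero_add]
  refine Finset.sum_congr rfl fun k hk => ?_
  rw [if_neg (Finset.ne_of_mem_erase hk), one_mul]

theorem sum_ite_eq_zero_one (i : Fin d) : ∑ k, (if k = i then (0 : ℝ) else 1) = d - 1 := by
  have : ∀ k, (if k = i then (0 : ℝ) else 1) = 1 - if k = i then 1 else 0 := fun k => by
    split_ifs <;> norm_num
  simp_rw [this, Finset.sum_sub_distrib]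
  simp

/-- The squared norm of the orthogonal component of a standard Gaussian vector is square
integrable with mean `d - 1` and variance `2 (d - 1)`. -/
theorem moments_norm_sq_sub_inner_sq {z : Euc d} (hz : ‖z‖ = 1) :
    MemLp (fun x => ‖x‖ ^ 2 - ⟪z, x⟫ ^ 2) 2 (stdGaussian (Euc d)) ∧
      ∫ x, ‖x‖ ^ 2 - ⟪z, x⟫ ^ 2 ∂(stdGaussian (Euc d)) = d - 1 ∧
      Var[fun x => ‖x‖ ^ 2 - ⟪z, x⟫ ^ 2; stdGaussian (Euc d)] = 2 * (d - 1) := by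
  have hd : 0 < d := by
    rcases Nat.eq_zero_or_pos d with rfl | h
    · simp [Subsingleton.elim z 0] at hz
    · exact h
  obtain ⟨b, rfl⟩ := exists_orthonormalBasis_apply_eq hz ⟨0, hd⟩
  set i : Fin d := ⟨0, hd⟩
  set c : Fin d → ℝ := fun k => if k = i then 0 else 1
  set F : (Fin d → ℝ) → ℝ := ∑ k, fun y => (fun t => c k * t ^ 2) (y k) with hF
  have hFm : Measurable F := by
    have : F = fun y => ∑ k, c k * y k ^ 2 := by ext y; simp [F]
    rw [this]
    fun_prop
  have hmp := stdGaussian_map_orthonormalBasis b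
  have hfun : (fun x => ‖x‖ ^ 2 - ⟪b i, x⟫ ^ 2) = F ∘ fun x k => ⟪b k, x⟫ := by
    ext x
    simp [norm_sq_sub_inner_sq_eq_sum, F, c]
  have hX : ∀ k, MemLp (fun t => c k * t ^ 2) 2 (gaussianReal 0 1) := fun k =>
    memLp_sq_gaussianReal.const_mul (c k)
  have hXk : ∀ k, MemLp (fun y : Fin d → ℝ => c k * y k ^ 2) 2
      (Measure.pi fun _ : Fin d => gaussianReal 0 1) := fun k =>
    (hX k).comp_measurePreserving (measurePreserving_eval _ k)
  have hFL : MemLp F 2 (Measure.pi fun _ : Fin d => gaussianReal 0 1) :=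
    memLp_finsetSum' _ fun k _ => hXk k
  have hint : ∫ x, ‖x‖ ^ 2 - ⟪b i, x⟫ ^ 2 ∂(stdGaussian (Euc d)) = d - 1 := by
    calc ∫ x, ‖x‖ ^ 2 - ⟪b i, x⟫ ^ 2 ∂(stdGaussian (Euc d))
        = ∫ x, F (fun k => ⟪b k, x⟫) ∂(stdGaussian (Euc d)) :=
          integral_congr_ae (ae_of_all _ fun x => congrFun hfun x)
      _ = ∫ y, F y ∂(Measure.pi fun _ : Fin d => gaussianReal 0 1) := by
          rw [← hmp.map_eq, integral_map hmp.measurable.aemeasurable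
            hFm.aestronglyMeasurable]
      _ = ∑ k, ∫ y, c k * y k ^ 2 ∂(Measure.pi fun _ : Fin d => gaussianReal 0 1) := by
          rw [← integral_finsetSum _ fun k _ => (hXk k).integrable (by norm_num)]
          simp [F]
      _ = ∑ k, c k := by
          refine Finset.sum_congr rfl fun k _ => ?_
          have h1 := (measurePreserving_eval (fun _ : Fin d => gaussianReal 0 1) k)
          have h2 : ∫ t, t ^ 2 ∂(gaussianReal 0 1)
              = ∫ y : Fin d → ℝ, y k ^ 2 ∂(Measure.pi fun _ : Fin d => gaussianReal 0 1) := by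
            rw [← integral_map (φ := Function.eval k) (f := fun t : ℝ => t ^ 2)
              h1.measurable.aemeasurable (by fun_prop), h1.map_eq]
          rw [integral_const_mul, ← h2, integral_sq_gaussianReal, mul_one]
      _ = d - 1 := sum_ite_eq_zero_one i
  refine ⟨?_, hint, ?_⟩
  · rw [hfun]
    exact hFL.comp_measurePreserving hmp
  · rw [hfun, ← variance_map (by rw [hmp.map_eq]; exact hFm.aemeasurable)
      hmp.measurable.aemeasurable, hmp.map_eq, hF, variance_sum_pi hX]
    simp_rw [variance_const_mul, variance_sq_gaussianReal, ← Finset.sum_mul]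
    have : ∀ k, c k ^ 2 = c k := fun k => by simp only [c]; split_ifs <;> norm_num
    simp_rw [this]
    rw [sum_ite_eq_zero_one]
    ring

end StdGaussian

/-! ### Probability that the noise is small -/

instance (d : ℕ) : IsProbabilityMeasure (gaussianNoise d) := by
  rw [gaussianNoise]; infer_instance

theorem measurePreserving_eval_gaussianNoise {d : ℕ} (j : Fin d) :
    MeasurePreserving (fun g => g j) (gaussianNoise d) (stdGaussian (Euc d)) :=
  measurePreserving_eval _ j

section Noise

variable {d : ℕ} {z : Euc d}

/-- Chebyshev's inequality; by independence of the columns, the sum has mean `d * (d - 1)` and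
variance `2 * d * (d - 1)`. -/
theorem gaussianNoise_perp_le (hz : ‖z‖ = 1) {t : ℝ} (ht : d * (d - 1) < t) :
    (gaussianNoise d).real {g | t < ∑ j, (‖g j‖ ^ 2 - ⟪z, g j⟫ ^ 2)}
      ≤ 2 * d * (d - 1) / (t - d * (d - 1)) ^ 2 := by
  obtain ⟨h1, h2, h3⟩ := moments_norm_sq_sub_inner_sq hz
  set f : Euc d → ℝ := fun x => ‖x‖ ^ 2 - ⟪z, x⟫ ^ 2 with hf
  set W : (Fin d → Euc d) → ℝ := ∑ j, fun g => f (g j) with hW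
  have hfj : ∀ j, MemLp (fun g : Fin d → Euc d => f (g j)) 2 (gaussianNoise d) := fun j =>
    h1.comp_measurePreserving (measurePreserving_eval_gaussianNoise j)
  have hWL : MemLp W 2 (gaussianNoise d) := memLp_finsetSum' _ fun j _ => hfj j
  have hvar : Var[W; gaussianNoise d] = 2 * d * (d - 1) := by
    rw [hW, gaussianNoise, variance_sum_pi fun _ => h1]
    simp only [h3, Finset.sum_const, Finset.card_univ, Fintype.card_fin, nsmul_eq_mul]
    ring
  have hmean : ∫ g, W g ∂(gaussianNoise d) = d * (d - 1) := by
    calc ∫ g, W g ∂(gaussianNoise d) = ∑ j, ∫ g, f (g j) ∂(gaussianNoise d) := by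
          rw [← integral_finsetSum _ fun j _ => (hfj j).integrable (by norm_num)]
          simp [W]
      _ = ∑ _j : Fin d, ((d : ℝ) - 1) := by
          refine Finset.sum_congr rfl fun j _ => ?_
          have hj := measurePreserving_eval_gaussianNoise j
          rw [← h2, ← hj.map_eq, integral_map hj.measurable.aemeasurable]
          rw [hj.map_eq]
          exact h1.1
      _ = _ := by simp [mul_sub]
  have hc : 0 < t - d * (d - 1) := by linarith
  have hcheb := meas_ge_le_variance_div_sq hWL hc
  rw [hvar, hmean] at hcheb
  refine ENNReal.toReal_le_of_le_ofReal ?_ ((measure_mono fun g hg => ?_).trans hcheb)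
  · rw [← hvar]; exact div_nonneg (variance_nonneg _ _) (sq_nonneg _)
  · simp only [Set.mem_ofPred_eq] at hg ⊢
    refine le_trans ?_ (le_abs_self _)
    simp only [hW, Finset.sum_apply, hf]
    linarith

theorem gaussianNoise_axis_le (hz : ‖z‖ = 1) {t : ℝ} (ht : 0 < t) :
    (gaussianNoise d).real {g | t < ∑ j, ⟪z, g j⟫ ^ 2} ≤ d / t := by
  refine ENNReal.toReal_le_of_le_ofReal (by positivity) ?_
  have h := mul_meas_ge_le_lintegral₀ (μ := gaussianNoise d)
    (f := fun g => ENNReal.ofReal (∑ j, ⟪z, g j⟫ ^ 2))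
    (Measurable.aemeasurable (by fun_prop)) (ENNReal.ofReal t)
  have h2 : ∫⁻ g, ENNReal.ofReal (∑ j, ⟪z, g j⟫ ^ 2) ∂(gaussianNoise d) = d := by
    simp_rw [ENNReal.ofReal_sum_of_nonneg (fun _ _ => sq_nonneg _)]
    rw [lintegral_finsetSum _ fun _ _ => by fun_prop]
    have : ∀ j, ∫⁻ g : Fin d → Euc d, ENNReal.ofReal (⟪z, g j⟫ ^ 2) ∂(gaussianNoise d) = 1 := by
      intro j
      rw [(measurePreserving_eval_gaussianNoise j).lintegral_comp
        (f := fun x => ENNReal.ofReal (⟪z, x⟫ ^ 2)) (by fun_prop),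
        lintegral_inner_sq_stdGaussian, hz]
      simp
    simp [this]
  rw [h2, mul_comm, ← ENNReal.le_div_iff_mul_le (by simp [ht]) (by simp)] at h
  rw [ENNReal.ofReal_div_of_pos ht, ENNReal.ofReal_natCast]
  refine (measure_mono fun g hg => ?_).trans h
  simp only [Set.mem_ofPred_eq] at hg ⊢
  exact ENNReal.ofReal_le_ofReal hg.le

theorem gaussianNoise_two_axis_le {e : Euc 2} (he : ‖e‖ = 1) {t : ℝ} (ht : 0 ≤ t) :
    (gaussianNoise 2).real {g | t < ∑ j, ⟪e, g j⟫ ^ 2} ≤ Real.exp (-t / 2) := by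
  refine ENNReal.toReal_le_of_le_ofReal (by positivity) ?_
  refine le_trans ?_ (prod_gaussianReal_le_sq_add_sq ht)
  have h1 : MeasurePreserving (fun (g : Fin 2 → Euc 2) j => ⟪e, g j⟫) (gaussianNoise 2)
      (Measure.pi fun _ : Fin 2 => gaussianReal 0 1) :=
    measurePreserving_pi _ _ fun _ => stdGaussian_map_inner he
  have h2 := (measurePreserving_finTwoArrow (gaussianReal 0 1)).comp h1
  rw [← h2.measure_preimage
    (measurableSet_le (by fun_prop) (by fun_prop) : MeasurableSet _).nullMeasurableSet]
  refine measure_mono fun g hg => ?_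
  simp only [Set.mem_ofPred_eq, Fin.sum_univ_two, Set.mem_preimage] at hg ⊢
  exact hg.le

/-- In the plane the part orthogonal to `z` is a single coordinate, so the axis estimate applies to
the other basis vector. -/
theorem gaussianNoise_two_perp_le {z : Euc 2} (hz : ‖z‖ = 1) {t : ℝ} (ht : 0 ≤ t) :
    (gaussianNoise 2).real {g | t < ∑ j, (‖g j‖ ^ 2 - ⟪z, g j⟫ ^ 2)} ≤ Real.exp (-t / 2) := by
  obtain ⟨b, rfl⟩ := exists_orthonormalBasis_apply_eq hz 0
  refine le_of_eq_of_le ?_ (gaussianNoise_two_axis_le (b.norm_eq_one 1) ht)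
  congr 1
  ext g
  simp only [norm_sq_sub_inner_sq_eq_sum b 0]
  simp

end Noise

variable {d : ℕ}

theorem log_three_gt : (1097 / 1000 : ℝ) < Real.log 3 := by
  have h1 : Real.log (2 ^ 19) ≤ Real.log (3 ^ 12) := Real.log_le_log (by norm_num) (by norm_num)
  rw [Real.log_pow, Real.log_pow] at h1
  have h2 := Real.log_two_gt_d9
  push_cast at h1
  linarith

/-- The noise is small with probability at least `0.585`. -/
theorem gaussianNoise_not_smallNoise_le (hd : 2 ≤ d) {z : Euc d} (hz : ‖z‖ = 1) {σ r : ℝ}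
    (hσ : σ ^ 2 * ((d : ℝ) ^ 3 * Real.log d) ≤ r ^ 2) :
    (gaussianNoise d).real {g | ¬ SmallNoise z σ r g} ≤ 83 / 200 := by
  have hd' : (2 : ℝ) ≤ d := by exact_mod_cast hd
  have hd1 : (0 : ℝ) < d - 1 := by linarith
  set L := Real.log d with hL
  have hL0 : 0 < L := Real.log_pos (by linarith)
  set T := (d : ℝ) ^ 3 * L / (d - 1) with hT
  set S := (d : ℝ) ^ 3 * L / 2 with hS
  have hsub : {g | ¬ SmallNoise z σ r g} ⊆ {g | T < ∑ j, (‖g j‖ ^ 2 - ⟪z, g j⟫ ^ 2)} ∪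
      {g | S < ∑ j, ⟪z, g j⟫ ^ 2} := by
    intro g hg
    by_contra! H
    simp only [Set.mem_union, Set.mem_ofPred_eq, not_or, not_lt] at H hg
    refine hg ⟨?_, ?_⟩
    · calc _ ≤ σ ^ 2 * T := by gcongr; exact H.1
        _ = σ ^ 2 * ((d : ℝ) ^ 3 * L) / (d - 1) := by rw [hT]; ring
        _ ≤ _ := by gcongr
    · calc _ ≤ σ ^ 2 * S := by gcongr; exact H.2
        _ = σ ^ 2 * ((d : ℝ) ^ 3 * L) / 2 := by rw [hS]; ring
        _ ≤ _ := by gcongr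
  refine (measureReal_mono hsub).trans ((measureReal_union_le _ _).trans ?_)
  rcases hd.eq_or_lt with rfl | hd3
  · have hT' : T = 2 * S := by rw [hT, hS]; push_cast; ring
    have hS0 : 0 ≤ S := by positivity
    -- For `d = 2`, `S = 4 * log 2`; the two tails are at most `1 / 16` and `1 / 4`.
    have hexp : Real.exp (-S / 2) = 1 / 4 := by
      have : -S / 2 = -(Real.log 2 + Real.log 2) := by rw [hS, hL]; push_cast; ring
      rw [this, Real.exp_neg, Real.exp_add, Real.exp_log two_pos]
      norm_num
    have h1 := gaussianNoise_two_perp_le hz (t := T) (by positivity)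
    have h2 := gaussianNoise_two_axis_le hz hS0
    rw [hT', show -(2 * S) / 2 = -S / 2 + -S / 2 by ring, Real.exp_add, hexp] at h1
    rw [hexp] at h2
    rw [hT']
    linarith
  · have hd3' : (3 : ℝ) ≤ d := by exact_mod_cast hd3
    have hL1 : 1097 / 1000 ≤ L :=
      log_three_gt.le.trans (Real.log_le_log (by norm_num) hd3')
    have hT1 : 1097 / 1000 * ((d : ℝ) ^ 2 + d + 1) ≤ T := by
      -- Uses `d ^ 3 - 1 = (d - 1) * (d ^ 2 + d + 1)`.
      rw [hT, le_div_iff₀ hd1]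
      have : (d : ℝ) ^ 3 * (1097 / 1000) ≤ (d : ℝ) ^ 3 * L := by gcongr
      nlinarith
    set x := (d : ℝ)
    have hgap : 97 / 1000 * x ^ 2 + 2097 / 1000 * x + 1097 / 1000 ≤ T - x * (x - 1) := by linarith
    have hgap0 : 0 < 97 / 1000 * x ^ 2 + 2097 / 1000 * x + 1097 / 1000 := by positivity
    have h1 := gaussianNoise_perp_le hz (t := T) (by linarith)
    have h2 := gaussianNoise_axis_le hz (t := S) (by positivity)
    -- The bounds `21 / 100` here and `41 / 200` in `h4` add up to `83 / 200`. The Chebyshev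
    -- quotient peaks between `5` and `6`, hence the squares centered at `5`.
    have h3 : 2 * x * (x - 1) / (T - x * (x - 1)) ^ 2 ≤ 21 / 100 := by
      rw [div_le_iff₀ (pow_pos (hgap0.trans_le hgap) 2)]
      calc 2 * x * (x - 1)
          ≤ 21 / 100 * (97 / 1000 * x ^ 2 + 2097 / 1000 * x + 1097 / 1000) ^ 2 := by
            nlinarith [sq_nonneg (x - 5), sq_nonneg (x ^ 2 - 5 * x), sq_nonneg (x ^ 2 - 25),
              mul_nonneg (sq_nonneg (x - 5)) (by linarith : (0 : ℝ) ≤ x)]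
        _ ≤ _ := by gcongr
    have h4 : x / S ≤ 41 / 200 := by
      rw [hS, div_div_eq_mul_div, div_le_iff₀ (by positivity)]
      have : x * 9 * (1097 / 1000) ≤ x ^ 3 * L := by
        have : x * 9 ≤ x ^ 3 := by nlinarith
        gcongr
      linarith
    linarith

/-! ### A Gaussian hyperplane against the smoothed simplex -/

theorem stdGaussian_exists_le {u : Fin d → Euc d} {r : ℝ} (hd : 2 ≤ d) (hr : 0 < r)
    (hr1 : r ^ 2 * (90000 * Real.log d) = 1) (hu : ∀ j, ‖u j‖ = r) :
    (stdGaussian (Euc d)).real {x | ∃ j, 1 / 50 ≤ |⟪u j, x⟫|} ≤ 1 / 2 ^ 16 := by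
  have hd' : (2 : ℝ) ≤ d := by exact_mod_cast hd
  have hset : {x | ∃ j, 1 / 50 ≤ |⟪u j, x⟫|} = ⋃ j, {x | 1 / 50 ≤ |⟪u j, x⟫|} := by
    ext; simp
  -- With `r = 1 / (300 * √(log d))` the threshold is `6 * √(log d)` standard deviations, so each
  -- tail is of order `d ^ (-18)` and survives the union bound over `d` vertices.
  have hexp : Real.exp (-(1 / (50 * r)) ^ 2 / 2) = ((d : ℝ) ^ 18)⁻¹ := by
    have : -(1 / (50 * r)) ^ 2 / 2 = -(18 * Real.log d) := by
      field_simp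
      linarith
    rw [this, Real.exp_neg, show (18 : ℝ) = ((18 : ℕ) : ℝ) by norm_num, Real.exp_nat_mul,
      Real.exp_log (by linarith)]
  have hj : ∀ j, (stdGaussian (Euc d)).real {x | 1 / 50 ≤ |⟪u j, x⟫|} ≤ 2 * ((d : ℝ) ^ 18)⁻¹ := by
    intro j
    rw [← hexp]
    refine ENNReal.toReal_le_of_le_ofReal (by positivity) ?_
    refine le_trans (le_of_eq ?_) (gaussianReal_le_abs (by positivity : 0 ≤ 1 / (50 * r)))
    have h1 : MeasurePreserving (fun x => ⟪r⁻¹ • u j, x⟫) (stdGaussian (Euc d))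
        (gaussianReal 0 1) := stdGaussian_map_inner (by
      rw [norm_smul, hu, norm_inv, Real.norm_eq_abs, abs_of_pos hr, inv_mul_cancel₀ hr.ne'])
    rw [← h1.measure_preimage
      (measurableSet_le (by fun_prop) (by fun_prop) : MeasurableSet _).nullMeasurableSet]
    congr 1
    ext x
    simp only [Set.mem_ofPred_eq, Set.mem_preimage, real_inner_smul_left, abs_mul, abs_inv,
      abs_of_pos hr]
    rw [one_div, one_div, mul_inv, mul_comm, inv_mul_le_iff₀ hr, mul_inv_cancel_left₀ hr.ne']
  rw [hset]
  refine (measureReal_iUnion_fintype_le _).trans ?_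
  calc ∑ j, (stdGaussian (Euc d)).real {x | 1 / 50 ≤ |⟪u j, x⟫|}
      ≤ ∑ _j : Fin d, 2 * ((d : ℝ) ^ 18)⁻¹ := Finset.sum_le_sum fun j _ => hj j
    _ = 2 * ((d : ℝ) ^ 17)⁻¹ := by
      rw [Finset.sum_const, Finset.card_univ, Fintype.card_fin, nsmul_eq_mul]
      field_simp
    _ ≤ 2 * ((2 : ℝ) ^ 17)⁻¹ := by gcongr
    _ = _ := by norm_num

theorem stdGaussian_abs_inner_le {z : Euc d} (hz : ‖z‖ = 1) :
    (stdGaussian (Euc d)).real {x | |⟪z, x⟫| ≤ 1 / 25} ≤ 4 / 125 := by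
  refine ENNReal.toReal_le_of_le_ofReal (by norm_num) ?_
  have h := gaussianReal_abs_le (1 / 25)
  rw [← (stdGaussian_map_inner hz).measure_preimage
    (measurableSet_le (by fun_prop) (by fun_prop) : MeasurableSet _).nullMeasurableSet] at h
  refine h.trans (le_of_eq ?_)
  norm_num

/-- Markov's inequality for the sum of squares: given the noise, `⟪x, g j⟫` has second moment `‖g j‖
^ 2`, whose mean is `d`, so the total is `σ ^ 2 * d ^ 2`. -/
theorem prod_exists_le_abs_inner {σ r : ℝ} (hd : 2 ≤ d)
    (hσ : σ ^ 2 * ((d : ℝ) ^ 3 * Real.log d) ≤ r ^ 2)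
    (hr1 : r ^ 2 * (90000 * Real.log d) = 1) :
    ((gaussianNoise d).prod (stdGaussian (Euc d))).real
      {p | ∃ j, 1 / 50 ≤ |σ * ⟪p.2, p.1 j⟫|} ≤ 3 / 100 := by
  have hd' : (2 : ℝ) ≤ d := by exact_mod_cast hd
  set L := Real.log d with hL
  have hL1 : 693 / 1000 ≤ L := by
    have := Real.log_two_gt_d9
    exact (by linarith : (693 / 1000 : ℝ) ≤ Real.log 2).trans (Real.log_le_log two_pos hd')
  refine ENNReal.toReal_le_of_le_ofReal (by norm_num) ?_
  have h := mul_meas_ge_le_lintegral₀ (μ := (gaussianNoise d).prod (stdGaussian (Euc d)))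
    (f := fun p => ∑ j, ENNReal.ofReal (σ ^ 2) * ENNReal.ofReal (⟪p.1 j, p.2⟫ ^ 2))
    (Measurable.aemeasurable (by fun_prop)) (ENNReal.ofReal (1 / 2500))
  have h2 : ∫⁻ p : (Fin d → Euc d) × Euc d,
      ∑ j, ENNReal.ofReal (σ ^ 2) * ENNReal.ofReal (⟪p.1 j, p.2⟫ ^ 2)
        ∂((gaussianNoise d).prod (stdGaussian (Euc d))) = ENNReal.ofReal (σ ^ 2 * d ^ 2) := by
    rw [lintegral_finsetSum _ fun _ _ => by fun_prop]
    have : ∀ j, ∫⁻ p : (Fin d → Euc d) × Euc d,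
        ENNReal.ofReal (σ ^ 2) * ENNReal.ofReal (⟪p.1 j, p.2⟫ ^ 2)
        ∂((gaussianNoise d).prod (stdGaussian (Euc d))) = ENNReal.ofReal (σ ^ 2) * d := by
      intro j
      rw [lintegral_const_mul _ (by fun_prop),
        lintegral_prod _ (Measurable.aemeasurable (by fun_prop))]
      simp_rw [lintegral_inner_sq_stdGaussian]
      rw [(measurePreserving_eval_gaussianNoise j).lintegral_comp
        (f := fun x => ENNReal.ofReal (‖x‖ ^ 2)) (by fun_prop), lintegral_norm_sq_stdGaussian]
    simp only [this, Finset.sum_const, Finset.card_univ, Fintype.card_fin, nsmul_eq_mul]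
    rw [ENNReal.ofReal_mul (sq_nonneg _), sq (d : ℝ), ENNReal.ofReal_mul (by positivity),
      ENNReal.ofReal_natCast]
    ring
  rw [h2, mul_comm, ← ENNReal.le_div_iff_mul_le (by simp) (by simp),
    ← ENNReal.ofReal_div_of_pos (by norm_num)] at h
  refine (measure_mono fun p hp => ?_).trans (h.trans (ENNReal.ofReal_le_ofReal ?_))
  · obtain ⟨j, hj⟩ := hp
    simp only [Set.mem_ofPred_eq]
    refine le_trans ?_ (Finset.single_le_sum (fun _ _ => zero_le) (Finset.mem_univ j))
    rw [← ENNReal.ofReal_mul (sq_nonneg _)]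
    refine ENNReal.ofReal_le_ofReal ?_
    rw [← mul_pow, real_inner_comm, ← sq_abs (σ * _)]
    calc (1 / 2500 : ℝ) = (1 / 50) ^ 2 := by norm_num
      _ ≤ _ := by gcongr
  · rw [div_le_iff₀ (by norm_num)]
    have h3 : σ ^ 2 * (d : ℝ) ^ 2 * (2 * L * (90000 * L)) ≤ 1 := by
      calc σ ^ 2 * (d : ℝ) ^ 2 * (2 * L * (90000 * L))
          ≤ σ ^ 2 * (d : ℝ) ^ 2 * (d * L * (90000 * L)) := by gcongr
        _ = σ ^ 2 * ((d : ℝ) ^ 3 * L) * (90000 * L) := by ring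
        _ ≤ r ^ 2 * (90000 * L) := by gcongr
        _ = 1 := hr1
    have h4 : σ ^ 2 * (d : ℝ) ^ 2 * (2 * (693 / 1000) * (90000 * (693 / 1000))) ≤ 1 := by
      refine le_trans ?_ h3
      gcongr
    linarith

theorem measurableSet_smallNoise (z : Euc d) (σ r : ℝ) : MeasurableSet {g | SmallNoise z σ r g} := by
  have : {g | SmallNoise z σ r g} =
      {g | σ ^ 2 * ∑ j, (‖g j‖ ^ 2 - ⟪z, g j⟫ ^ 2) ≤ r ^ 2 / (d - 1)} ∩
        {g | σ ^ 2 * ∑ j, ⟪z, g j⟫ ^ 2 ≤ r ^ 2 / 2} := by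
    ext; simp [SmallNoise]
  rw [this]
  exact (measurableSet_le (by fun_prop) (by fun_prop)).inter
    (measurableSet_le (by fun_prop) (by fun_prop))

/-- With probability at least `1 / 4`, the noise is small and all the smoothed vertices are on the
negative side of a random hyperplane. -/
theorem one_fourth_le_prod_smallNoise (hd : 2 ≤ d) {z : Euc d} {v : Fin d → Euc d} {σ r : ℝ}
    (hr : 0 < r) (hr1 : r ^ 2 * (90000 * Real.log d) = 1)
    (hσ : σ ^ 2 * ((d : ℝ) ^ 3 * Real.log d) ≤ r ^ 2) (hv : IsRegularSimplex z v r) :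
    1 / 4 ≤ ((gaussianNoise d).prod (stdGaussian (Euc d)))
      {p | SmallNoise z σ r p.1 ∧ ∀ j, ⟪p.2, v j + σ • p.1 j⟫ ≤ 0} := by
  set P := (gaussianNoise d).prod (stdGaussian (Euc d)) with hP
  set N := {p : (Fin d → Euc d) × Euc d |
    SmallNoise z σ r p.1 ∧ ∀ j, ⟪p.2, v j + σ • p.1 j⟫ ≤ 0} with hN
  have hz := hv.norm_center
  have hNm : MeasurableSet N := by
    have : N = Prod.fst ⁻¹' {g | SmallNoise z σ r g} ∩
        ⋂ j, {p | ⟪p.2, v j + σ • p.1 j⟫ ≤ 0} := by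
      ext; simp [hN]
    rw [this]
    exact (measurable_fst (measurableSet_smallNoise z σ r)).inter
      (MeasurableSet.iInter fun j => measurableSet_le (by fun_prop) (by fun_prop))
  have hsymm : MeasurePreserving (Prod.map id fun x : Euc d => -x) P P :=
    (MeasurePreserving.id _).prod
      ⟨by fun_prop, stdGaussian_map (LinearIsometryEquiv.neg ℝ (E := Euc d))⟩
  set N' := Prod.map id (fun x : Euc d => -x) ⁻¹' N with hN'
  have hNN' : P.real N' = P.real N := by
    rw [measureReal_def, measureReal_def, hsymm.measure_preimage hNm.nullMeasurableSet]
  set B₁ : Set ((Fin d → Euc d) × Euc d) := Prod.fst ⁻¹' {g | ¬ SmallNoise z σ r g}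
  set B₂ : Set ((Fin d → Euc d) × Euc d) := Prod.snd ⁻¹' {x | |⟪z, x⟫| ≤ 1 / 25}
  set B₃ : Set ((Fin d → Euc d) × Euc d) := Prod.snd ⁻¹' {x | ∃ j, 1 / 50 ≤ |⟪v j - z, x⟫|}
  set B₄ : Set ((Fin d → Euc d) × Euc d) := {p | ∃ j, 1 / 50 ≤ |σ * ⟪p.2, p.1 j⟫|}
  have h1 : P.real B₁ ≤ 83 / 200 := by
    refine le_of_eq_of_le ?_ (gaussianNoise_not_smallNoise_le hd hz hσ)
    have hm : MeasurableSet {g | ¬ SmallNoise z σ r g} := (measurableSet_smallNoise z σ r).compl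
    rw [measureReal_def, measureReal_def,
      measurePreserving_fst.measure_preimage hm.nullMeasurableSet]
  have h2 : P.real B₂ ≤ 4 / 125 := by
    refine le_of_eq_of_le ?_ (stdGaussian_abs_inner_le hz)
    rw [measureReal_def, measureReal_def, measurePreserving_snd.measure_preimage
      (measurableSet_le (by fun_prop) (by fun_prop) : MeasurableSet _).nullMeasurableSet]
  have h3 : P.real B₃ ≤ 1 / 2 ^ 16 := by
    refine le_of_eq_of_le ?_ (stdGaussian_exists_le hd hr hr1 (u := fun j => v j - z)
      fun j => by rw [norm_sub_rev]; exact hv.radius j)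
    rw [measureReal_def, measureReal_def, measurePreserving_snd.measure_preimage]
    refine MeasurableSet.nullMeasurableSet (MeasurableSet.congr (MeasurableSet.iUnion fun j =>
      measurableSet_le (f := fun _ => 1 / 50) (g := fun x : Euc d => |⟪v j - z, x⟫|)
        (by fun_prop) (by fun_prop)) (by ext; simp))
  have h4 : P.real B₄ ≤ 3 / 100 := prod_exists_le_abs_inner hd hσ hr1
  -- Outside the bad events `|⟪z, x⟫| > 1 / 25 = 1 / 50 + 1 / 50` dominates both deviations, so
  -- every vertex shares the sign of `⟪z, x⟫`, and either `x` or `-x` succeeds.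
  have hcover : (Set.univ : Set ((Fin d → Euc d) × Euc d)) ⊆ N ∪ N' ∪ (B₁ ∪ B₂ ∪ (B₃ ∪ B₄)) := by
    rintro ⟨g, x⟩ -
    by_contra H
    simp only [Set.mem_union, not_or, B₁, B₂, B₃, B₄, Set.mem_preimage, Set.mem_ofPred_eq, not_not,
      not_le, not_exists] at H
    obtain ⟨⟨hgN, hgN'⟩, ⟨hg1, hg2⟩, hg3, hg4⟩ := H
    have hin : ∀ j, ⟪x, v j + σ • g j⟫ = ⟪z, x⟫ + (⟪v j - z, x⟫ + σ * ⟪x, g j⟫) := fun j => by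
      rw [inner_add_right, inner_smul_right, inner_sub_left, real_inner_comm (v j),
        real_inner_comm x z]
      ring
    rcases lt_abs.1 hg2 with hpos | hneg
    · refine hgN' ?_
      simp only [hN', hN, Set.mem_preimage, Set.mem_ofPred_eq, Prod.map, id, inner_neg_left]
      refine ⟨hg1, fun j => ?_⟩
      have := (abs_lt.1 (hg3 j)).1
      have := (abs_lt.1 (hg4 j)).1
      linarith [hin j]
    · refine hgN ⟨hg1, fun j => ?_⟩
      have := (abs_lt.1 (hg3 j)).2
      have := (abs_lt.1 (hg4 j)).2
      linarith [hin j]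
  have htot : 1 ≤ P.real N + P.real N' + (P.real B₁ + P.real B₂ + (P.real B₃ + P.real B₄)) := by
    calc 1 = P.real Set.univ := by simp
      _ ≤ P.real (N ∪ N' ∪ (B₁ ∪ B₂ ∪ (B₃ ∪ B₄))) := measureReal_mono hcover
      _ ≤ P.real (N ∪ N') + P.real (B₁ ∪ B₂ ∪ (B₃ ∪ B₄)) := measureReal_union_le _ _
      _ ≤ _ := by
        gcongr
        · exact measureReal_union_le _ _
        · refine (measureReal_union_le _ _).trans ?_
          gcongr <;> exact measureReal_union_le _ _
  -- The bad events total less than `0.478`, which leaves more than `1 / 2` for the two equiprobable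
  -- events.
  have hfin : 1 / 4 ≤ P.real N := by
    rw [hNN'] at htot
    norm_num at h3
    linarith
  rw [← ENNReal.ofReal_toReal (measure_ne_top P N)]
  refine le_trans (le_of_eq ?_) (ENNReal.ofReal_le_ofReal hfin)
  rw [ENNReal.ofReal_div_of_pos (by norm_num)]
  norm_num

/-! ### Haar measure and reduction to a Gaussian normal -/

section Rotations

variable {d : ℕ}

/-- The action of `O(d)` on `ℝ^d` by linear isometries. -/
noncomputable def rotateEquiv (d : ℕ) : O d ≃* (Euc d ≃ₗᵢ[ℝ] Euc d) :=
  (Unitary.mapEquiv (R := Matrix (Fin d) (Fin d) ℝ) (S := Euc d →L[ℝ] Euc d)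
    { Matrix.toEuclideanCLM (n := Fin d) (𝕜 := ℝ) with }).toMulEquiv.trans
    Unitary.linearIsometryEquiv

theorem rotateEquiv_apply (U : O d) (x : Euc d) : rotateEquiv d U x = rotate U x := rfl

theorem rotate_mul (U V : O d) (x : Euc d) : rotate (U * V) x = rotate U (rotate V x) := by
  rw [← rotateEquiv_apply, map_mul]; rfl

theorem inner_rotate (U : O d) (x y : Euc d) : ⟪rotate U x, rotate U y⟫ = ⟪x, y⟫ := by
  rw [← rotateEquiv_apply, ← rotateEquiv_apply, LinearIsometryEquiv.inner_map_map]

theorem norm_rotate (U : O d) (x : Euc d) : ‖rotate U x‖ = ‖x‖ := by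
  rw [← rotateEquiv_apply, LinearIsometryEquiv.norm_map]

theorem rotate_add (U : O d) (x y : Euc d) : rotate U (x + y) = rotate U x + rotate U y :=
  map_add _ _ _

theorem rotate_sub (U : O d) (x y : Euc d) : rotate U (x - y) = rotate U x - rotate U y :=
  map_sub _ _ _

theorem rotate_smul (U : O d) (t : ℝ) (x : Euc d) : rotate U (t • x) = t • rotate U x :=
  map_smul _ _ _

/-- The reflection in the hyperplane orthogonal to `x - y` exchanges the two vectors. -/
theorem exists_rotate_eq {x y : Euc d} (h : ‖x‖ = ‖y‖) : ∃ V : O d, rotate V x = y := by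
  obtain ⟨V, hV⟩ := (rotateEquiv d).surjective (Submodule.reflection (ℝ ∙ (x - y))ᗮ)
  refine ⟨V, ?_⟩
  rw [← rotateEquiv_apply, hV, Submodule.reflection_sub h]

theorem continuous_rotate : Continuous fun p : O d × Euc d => rotate p.1 p.2 := by
  have h : Continuous fun U : O d => (U : Matrix (Fin d) (Fin d) ℝ) := continuous_subtype_val
  refine (PiLp.continuous_toLp 2 _).comp (continuous_pi fun i => ?_)
  change Continuous fun p : O d × Euc d => ∑ j, (p.1 : Matrix (Fin d) (Fin d) ℝ) i j * p.2 j
  refine continuous_finsetSum _ fun j _ => ?_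
  refine Continuous.mul ?_ ?_
  · exact (continuous_apply_apply i j).comp (h.comp continuous_fst)
  · exact (EuclideanSpace.proj j : Euc d →L[ℝ] ℝ).continuous.comp continuous_snd

instance : SecondCountableTopology (O d) := by
  have : SecondCountableTopology (Matrix (Fin d) (Fin d) ℝ) :=
    inferInstanceAs (SecondCountableTopology (Fin d → Fin d → ℝ))
  exact TopologicalSpace.Subtype.secondCountableTopology _

instance : (haarO d).IsMulLeftInvariant := by
  unfold haarO; infer_instance

instance : IsProbabilityMeasure (haarO d) :=
  ⟨by simpa [haarO] using Measure.haarMeasure_self (K₀ := (⊤ : TopologicalSpace.PositiveCompacts (O d)))⟩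

theorem IsRegularSimplex.rotate {z : Euc d} {v : Fin d → Euc d} {r : ℝ}
    (h : IsRegularSimplex z v r) (U : O d) :
    IsRegularSimplex (rotate U z) (fun j => UnitLP.rotate U (v j)) r where
  norm_center := by rw [norm_rotate, h.norm_center]
  center := by
    conv_rhs => rw [← h.center]
    simp only [← rotateEquiv_apply, map_smul, map_sum]
  normal j := by rw [← rotate_sub, inner_rotate, h.normal]
  radius j := by rw [← rotate_sub, norm_rotate, h.radius]
  regular := by
    obtain ⟨s, hs⟩ := h.regular
    exact ⟨s, fun i j hij => by rw [← rotate_sub, norm_rotate, hs i j hij]⟩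

theorem smallNoise_rotate_iff (V : O d) (z : Euc d) (σ r : ℝ) (g : Fin d → Euc d) :
    SmallNoise (rotate V z) σ r (fun j => rotate V (g j)) ↔ SmallNoise z σ r g := by
  simp only [SmallNoise, inner_rotate, norm_rotate]

end Rotations

section RandomRotation

variable {d : ℕ} {z : Euc d} {v : Fin d → Euc d} {σ r : ℝ}

/-- The event that the noise is small with respect to the rotated simplex, and that the smoothed
vertices of the rotated simplex are in the half-space with outer normal `w`. -/
def goodEvent (z : Euc d) (v : Fin d → Euc d) (σ r : ℝ) (w : Euc d) :
    Set (O d × (Fin d → Euc d)) :=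
  {ω | SmallNoise (rotate ω.1 z) σ r ω.2 ∧ ∀ j, ⟪w, rotate ω.1 (v j) + σ • ω.2 j⟫ ≤ 0}

theorem measurableSet_smallNoise_and_inner {α : Type*} [MeasurableSpace α] {Z W : α → Euc d}
    {V G : α → Fin d → Euc d} (hZ : Measurable Z) (hW : Measurable W)
    (hV : ∀ j, Measurable fun p => V p j) (hG : ∀ j, Measurable fun p => G p j) (σ r : ℝ) :
    MeasurableSet {p | SmallNoise (Z p) σ r (G p) ∧ ∀ j, ⟪W p, V p j + σ • G p j⟫ ≤ 0} := by
  have : {p | SmallNoise (Z p) σ r (G p) ∧ ∀ j, ⟪W p, V p j + σ • G p j⟫ ≤ 0} =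
      {p | σ ^ 2 * ∑ j, (‖G p j‖ ^ 2 - ⟪Z p, G p j⟫ ^ 2) ≤ r ^ 2 / (d - 1)} ∩
        {p | σ ^ 2 * ∑ j, ⟪Z p, G p j⟫ ^ 2 ≤ r ^ 2 / 2} ∩
          ⋂ j, {p | ⟪W p, V p j + σ • G p j⟫ ≤ 0} := by
    ext; simp [SmallNoise]
  rw [this]
  exact ((measurableSet_le (by fun_prop) (by fun_prop)).inter
    (measurableSet_le (by fun_prop) (by fun_prop))).inter
      (MeasurableSet.iInter fun j => measurableSet_le (by fun_prop) (by fun_prop))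

theorem measurableSet_goodEvent_family (z : Euc d) (v : Fin d → Euc d) (σ r : ℝ) :
    MeasurableSet {p : (O d × (Fin d → Euc d)) × Euc d | p.1 ∈ goodEvent z v σ r p.2} := by
  have hrot : ∀ x : Euc d,
      Measurable fun p : (O d × (Fin d → Euc d)) × Euc d => rotate p.1.1 x := fun x =>
    (continuous_rotate.comp (Continuous.prodMk (continuous_fst.comp continuous_fst)
      continuous_const)).measurable
  exact measurableSet_smallNoise_and_inner (hrot z) measurable_snd (fun j => hrot (v j))
    (fun j => (measurable_pi_apply j).comp (measurable_snd.comp measurable_fst)) σ r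

theorem measurableSet_goodEvent (w : Euc d) : MeasurableSet (goodEvent z v σ r w) :=
  measurable_prodMk_right (y := w) (measurableSet_goodEvent_family z v σ r)

theorem measurePreserving_rotate_noise (V : O d) :
    MeasurePreserving (Prod.map (fun U => V * U) fun (g : Fin d → Euc d) j => rotate V (g j))
      ((haarO d).prod (gaussianNoise d)) ((haarO d).prod (gaussianNoise d)) := by
  have h : MeasurePreserving (fun x => rotate V x) (stdGaussian (Euc d)) (stdGaussian (Euc d)) :=
    ⟨(rotateEquiv d V).continuous.measurable, stdGaussian_map (rotateEquiv d V)⟩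
  exact (measurePreserving_mul_left (haarO d) V).prod (measurePreserving_pi _ _ fun _ => h)

/-- Replacing `U` by `V * U` and every `g j` by its image under `V` preserves the product measure
and carries one event to the other. -/
theorem measure_goodEvent_rotate (V : O d) (w : Euc d) :
    (haarO d).prod (gaussianNoise d) (goodEvent z v σ r (rotate V w))
      = (haarO d).prod (gaussianNoise d) (goodEvent z v σ r w) := by
  rw [← (measurePreserving_rotate_noise V).measure_preimage
    (measurableSet_goodEvent (rotate V w)).nullMeasurableSet]
  congr 1
  ext ω
  simp only [goodEvent, Set.mem_preimage, Set.mem_ofPred_eq, Prod.map, rotate_mul,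
    smallNoise_rotate_iff, ← rotate_smul, ← rotate_add, inner_rotate]

theorem goodEvent_smul {t : ℝ} (ht : 0 < t) (w : Euc d) :
    goodEvent z v σ r (t • w) = goodEvent z v σ r w := by
  ext ω
  simp only [goodEvent, Set.mem_ofPred_eq, real_inner_smul_left, mul_nonpos_iff, ht.le,
    ht.not_ge, true_and, false_and, or_false]

theorem measure_goodEvent_eq {w w' : Euc d} (hw : w ≠ 0) (hw' : w' ≠ 0) :
    (haarO d).prod (gaussianNoise d) (goodEvent z v σ r w)
      = (haarO d).prod (gaussianNoise d) (goodEvent z v σ r w') := by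
  have h : ‖(‖w'‖ / ‖w‖) • w‖ = ‖w'‖ := by
    rw [norm_smul, norm_div, norm_norm, norm_norm, div_mul_cancel₀ _ (norm_ne_zero_iff.2 hw)]
  obtain ⟨V, hV⟩ := exists_rotate_eq h
  rw [← hV, measure_goodEvent_rotate,
    goodEvent_smul (div_pos (norm_pos_iff.2 hw') (norm_pos_iff.2 hw))]

theorem stdGaussian_ae_ne_zero (hd : 2 ≤ d) : ∀ᵐ x ∂(stdGaussian (Euc d)), x ≠ 0 := by
  have h1 := stdGaussian_map_inner (e := EuclideanSpace.single (⟨0, by omega⟩ : Fin d) (1 : ℝ))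
    (by simp)
  have := nullSingletonClass_gaussianReal (μ := 0) one_ne_zero
  have h2 : ∀ᵐ t ∂(gaussianReal 0 1), t ≠ 0 := by
    rw [ae_iff]
    simp
  refine (h1.quasiMeasurePreserving.ae h2).mono fun x hx => ?_
  rintro rfl
  simp at hx

/-- The measure is the same for all nonzero normals, so it equals its average over a Gaussian
normal. After exchanging the integrals, the estimate holds for each fixed rotation, as the rotated
simplex is again regular. -/
theorem one_fourth_le_measure_goodEvent (hd : 2 ≤ d) (hr : 0 < r)
    (hr1 : r ^ 2 * (90000 * Real.log d) = 1)
    (hσ : σ ^ 2 * ((d : ℝ) ^ 3 * Real.log d) ≤ r ^ 2) (hv : IsRegularSimplex z v r) {w : Euc d}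
    (hw : w ≠ 0) :
    1 / 4 ≤ (haarO d).prod (gaussianNoise d) (goodEvent z v σ r w) := by
  set T := {p : (O d × (Fin d → Euc d)) × Euc d | p.1 ∈ goodEvent z v σ r p.2} with hT
  have hTm : MeasurableSet T := measurableSet_goodEvent_family z v σ r
  have h1 : (((haarO d).prod (gaussianNoise d)).prod (stdGaussian (Euc d))) T
      = (haarO d).prod (gaussianNoise d) (goodEvent z v σ r w) := by
    rw [Measure.prod_apply_symm hTm]
    have : ∀ᵐ x ∂(stdGaussian (Euc d)), (haarO d).prod (gaussianNoise d) ((fun p => (p, x)) ⁻¹' T)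
        = (haarO d).prod (gaussianNoise d) (goodEvent z v σ r w) := by
      filter_upwards [stdGaussian_ae_ne_zero hd] with x hx
      rw [← measure_goodEvent_eq hx hw]
      rfl
    rw [lintegral_congr_ae this]
    simp
  have hassoc := measurePreserving_prodAssoc (haarO d) (gaussianNoise d) (stdGaussian (Euc d))
  rw [← h1, ← (hassoc.symm _).measure_preimage hTm.nullMeasurableSet,
    Measure.prod_apply (MeasurableEquiv.measurable _ hTm)]
  calc (1 / 4 : ENNReal) = ∫⁻ _, 1 / 4 ∂(haarO d) := by simp
    _ ≤ _ := lintegral_mono fun U =>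
      one_fourth_le_prod_smallNoise hd hr hr1 hσ (hv.rotate U)

end RandomRotation

/-! ### Dilation and the choice of parameters -/

section Scaling

variable {d : ℕ} {z : Euc d} {b : Fin d → Euc d}

theorem smul_mem_cone {s : ℝ} (h : z ∈ cone b) : s • z ∈ cone fun j => s • b j := by
  obtain ⟨t, ht, rfl⟩ := h
  refine ⟨t, ht, ?_⟩
  rw [Finset.smul_sum]
  exact Finset.sum_congr rfl fun j _ => smul_comm _ _ _

theorem le_infDist_affineSpan [NeZero d] {M : ℝ}
    (h : ∀ μ : Fin d → ℝ, ∑ j, μ j = 1 → M ≤ ‖∑ j, μ j • b j‖) :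
    M ≤ Metric.infDist 0 (affineSpan ℝ (Set.range b) : Set (Euc d)) := by
  refine (Metric.le_infDist ⟨b 0, subset_affineSpan ℝ _ (Set.mem_range_self 0)⟩).2 fun y hy => ?_
  obtain ⟨μ, hμ, rfl⟩ := eq_affineCombination_of_mem_affineSpan_of_fintype hy
  rw [Finset.univ.affineCombination_eq_linear_combination _ _ hμ, dist_zero_left]
  exact h μ hμ

/-- The dilation by `2 * M₀` turns the distance `1 / 2` into `M₀ ≥ M`. -/
theorem noFailure_smul {M M₀ : ℝ} [NeZero d] (hM₀ : 0 ≤ M₀) (hM : M ≤ M₀) (hz : z ∈ cone b)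
    (hb : ∀ μ : Fin d → ℝ, ∑ j, μ j = 1 → 1 / 2 ≤ ‖∑ j, μ j • b j‖) :
    NoFailure M ((2 * M₀) • z) fun j => (2 * M₀) • b j := by
  refine ⟨smul_mem_cone hz, le_infDist_affineSpan fun μ hμ => hM.trans ?_⟩
  have : ∑ j, μ j • (2 * M₀) • b j = (2 * M₀) • ∑ j, μ j • b j := by
    rw [Finset.smul_sum]
    exact Finset.sum_congr rfl fun j _ => smul_comm _ _ _
  rw [this, norm_smul, Real.norm_eq_abs, abs_of_nonneg (by positivity)]
  nlinarith [hb μ hμ]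

theorem smoothedVertices_eq (M₀ σ : ℝ) (v : Fin d → Euc d) (U : O d) (g : Fin d → Euc d) :
    smoothedVertices M₀ σ v U g = fun j => (2 * M₀) • (rotate U (v j) + σ • g j) := by
  ext1 j
  rw [smoothedVertices, rotateDilate, smul_add, smul_smul]

end Scaling

section Parameters

variable {d : ℕ}

theorem simplexRadius_pos (hd : 2 ≤ d) : 0 < simplexRadius d := by
  have : 0 < Real.log d := Real.log_pos (by exact_mod_cast hd)
  unfold simplexRadius c₁
  positivity

theorem simplexRadius_sq (hd : 2 ≤ d) : simplexRadius d ^ 2 * (90000 * Real.log d) = 1 := by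
  have : 0 < Real.log d := Real.log_pos (by exact_mod_cast hd)
  rw [simplexRadius, c₁, div_pow, Real.sq_sqrt this.le]
  field_simp
  norm_num

theorem simplexRadius_le (hd : 2 ≤ d) : simplexRadius d ≤ 1 / 200 := by
  have h1 := simplexRadius_sq hd
  have h2 : 1 / 2 ≤ Real.log d := by
    have := Real.log_two_gt_d9
    exact (by linarith : (1 / 2 : ℝ) ≤ Real.log 2).trans
      (Real.log_le_log two_pos (by exact_mod_cast hd))
  refine (sq_le_sq₀ (simplexRadius_pos hd).le (by norm_num)).1 ?_
  nlinarith [sq_nonneg (simplexRadius d)]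

/-- The second entry of the minimum suffices: with `c ≤ c₁` it bounds the left side by `c₁ ^ 2 / log
d`. -/
theorem smoothing_sq_mul_le (hd : 2 ≤ d) (n : ℕ) {c : ℝ} (hc : 0 < c) (hc₁ : c ≤ c₁) :
    smoothing c n d ^ 2 * ((d : ℝ) ^ 3 * Real.log d) ≤ simplexRadius d ^ 2 := by
  have hL : 0 < Real.log d := Real.log_pos (by exact_mod_cast hd)
  have hd0 : (0 : ℝ) < d := by positivity
  have h0 : 0 ≤ smoothing c n d := le_min (by positivity) (by positivity)
  have h1 : smoothing c n d ≤ c₁ / ((d : ℝ) ^ (3 / 2 : ℝ) * Real.log d) :=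
    (min_le_right _ _).trans (by gcongr)
  have h2 : ((d : ℝ) ^ (3 / 2 : ℝ)) ^ 2 = (d : ℝ) ^ 3 := by
    rw [← Real.rpow_mul_natCast hd0.le, ← Real.rpow_natCast]
    norm_num
  calc smoothing c n d ^ 2 * ((d : ℝ) ^ 3 * Real.log d)
      ≤ (c₁ / ((d : ℝ) ^ (3 / 2 : ℝ) * Real.log d)) ^ 2 * ((d : ℝ) ^ 3 * Real.log d) := by gcongr
    _ = simplexRadius d ^ 2 := by
      rw [div_pow, mul_pow, h2, simplexRadius, div_pow, Real.sq_sqrt hL.le]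
      field_simp

end Parameters

end UnitLP

theorem theorem4p4 (d n : ℕ) (hd : 2 ≤ d) (hn : 2 ≤ n)
    -- the unit program, with a numb half-space
    (a : Fin n → Euc d) (z : Euc d) (ha : ∃ i, a i ≠ 0)
    (H : Set (Euc d)) (hH : UnitLP.IsNumbHalfSpace a z H)
    -- the size
    (M M₀ : ℝ) (hM : M = ⨆ i, ‖a i‖) (hM₀ : M ≤ M₀)
    -- the fixed regular simplex and the level of the smoothing
    (z₀' : Euc d) (v : Fin d → Euc d)
    (hv : UnitLP.IsRegularSimplex z₀' v (UnitLP.simplexRadius d))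
    (c : ℝ) (hc : 0 < c) (hc₁ : c ≤ UnitLP.c₁) :
    (∀ (U : UnitLP.O d) (b : Fin d → Euc d),
      UnitLP.NoFailure M (UnitLP.rotateDilate M₀ U z₀') b →
        (∃ x, UnitLP.IsOptimal (UnitLP.augment a b) (UnitLP.rotateDilate M₀ U z₀') x ∧
          ∀ j, ⟪b j, x⟫ = 1) ∧
        (UnitLP.GeneralPosition (UnitLP.augment a b) →
          UnitLP.IsSolution (UnitLP.augment a b) (UnitLP.rotateDilate M₀ U z₀')
            (UnitLP.addedIndices n d))) ∧
    1 / 4 ≤ ((UnitLP.haarO d).prod (UnitLP.gaussianNoise d))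
      {ω | UnitLP.NoFailure M (UnitLP.rotateDilate M₀ ω.1 z₀')
            (UnitLP.smoothedVertices M₀ (UnitLP.smoothing c n d) v ω.1 ω.2) ∧
          ∀ j, UnitLP.smoothedVertices M₀ (UnitLP.smoothing c n d) v ω.1 ω.2 j ∈ H} := by
  have : NeZero d := ⟨by omega⟩
  have haM : ∀ i, ‖a i‖ ≤ M := fun i => by
    rw [hM]; exact le_ciSup (f := fun i => ‖a i‖) (Set.finite_range _).bddAbove i
  have hMpos : 0 < M := by
    obtain ⟨i, hi⟩ := ha
    exact (norm_pos_iff.2 hi).trans_le (haM i)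
  refine ⟨fun U b hb => ?_, ?_⟩
  · obtain ⟨x, hx, hbx⟩ := hb.exists_isOptimal hMpos haM
    exact ⟨⟨x, hx, hbx⟩, UnitLP.isSolution_augment hx hbx⟩
  have hM₀pos : 0 < M₀ := hMpos.trans_le hM₀
  have hr := UnitLP.simplexRadius_pos hd
  obtain ⟨⟨w, rfl⟩, -⟩ := hH
  -- a nonzero normal vector of a half-space contained in `H`
  obtain ⟨w', hw', hww'⟩ : ∃ w' : Euc d, w' ≠ 0 ∧ ∀ x : Euc d, ⟪w', x⟫ ≤ 0 → ⟪w, x⟫ ≤ 0 := by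
    by_cases hw : w = 0
    · refine ⟨z₀', fun h => ?_, fun x _ => by simp [hw]⟩
      simpa [h] using hv.norm_center
    · exact ⟨w, hw, fun _ h => h⟩
  refine (UnitLP.one_fourth_le_measure_goodEvent hd hr (UnitLP.simplexRadius_sq hd)
    (UnitLP.smoothing_sq_mul_le hd n hc hc₁) hv hw').trans (measure_mono ?_)
  rintro ⟨U, g⟩ ⟨hg, hgw⟩
  simp only [Set.mem_ofPred_eq, UnitLP.smoothedVertices_eq]
  have hvU := hv.rotate U
  refine ⟨UnitLP.noFailure_smul hM₀pos.le hM₀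
    (UnitLP.mem_cone_of_smallNoise hd hr (UnitLP.simplexRadius_le hd) hvU hg)
    fun μ hμ => UnitLP.half_le_norm_of_smallNoise hd hr (UnitLP.simplexRadius_le hd) hvU hg hμ,
    fun j => ?_⟩
  rw [inner_smul_right]
  exact mul_nonpos_of_nonneg_of_nonpos (by positivity) (hww' _ (hgw j))
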